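/- Let $n\ge 2$ and $\epsilon\in\{1,-1\}$. A $2n$-dimensional smooth manifold $\mathcal M$ with a pseudo-Riemannian metric $\langle\cdot,\cdot\rangle$ (of any signature) and a smooth $(1,1)$-tensor field $J$ is called here a complex ($\epsilon=1$), respectively para-complex ($\epsilon=-1$), space form of (para-)holomorphic curvature $4c$ if $J^2=-\epsilon\,\mathrm{Id}$, $\langle J\cdot,J\cdot\rangle=\epsilon\langle\cdot,\cdot\rangle$, the $2$-form $\omega=\langle J\cdot,\cdot\rangle$ is closed, and the curvature tensor of the Levi-Civita connection satisfies $$R(X,Y)=c\,\bigl(\epsilon\,X\wedge Y+JX\wedge JY+2\langle X,JY\rangle J\bigr),\qquad (X\wedge Y)Z=\langle Y,Z\rangle X-\langle X,Z\rangle Y .$$ A real hypersurface of $\mathcal M$ is a non-empty smooth manifold of dimension $2n-1$ immersed in $\mathcal M$; it is non-degenerate if its induced metric is. Its shape operator $A$ with respect to a local unit normal field $N$ ($\langle N,N\rangle=\pm1$) is defined by $\nabla_XN=-AX$. It is umbilic if, around each point, $A=\lambda\,\mathrm{Id}$ for a smooth function $\lambda$ and some local unit normal field, and it has parallel shape operator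 if, around each point, $\overline\nabla A=0$ for some local unit normal field, $\overline\nabla$ being the Levi-Civita connection of the induced metric. (1) If $\mathcal M$ is a complex or para-complex space form of (para-)holomorphic curvature $4c\neq0$, then no non-degenerate real hypersurface of $\mathcal M$ is umbilic, and none has parallel shape operator. (2) The same holds for the following explicit spaces. Let $\mathbb A$ be the algebra of complex numbers $x+iy$ ($\epsilon=1$) or of para-complex numbers $x+\tau y$, $\tau^2=1$ ($\epsilon=-1$). Let $p\geq 0$ and $c=\pm1$, and equip $\mathbb A^{n+1}$ with the metric $-\sum_{j\le p}(dx_j^2+\epsilon\,dy_j^2)+\sum_{j>p}(dx_j^2+\epsilon\,dy_j^2)$. The space is the quotient of the hyperquadric $\{z\in\mathbb A^{n+1}:\langle z,z\rangle=c\}$ by the relation $z\sim(\cos\theta,\sin\theta)\cdot z$, $\theta\in\mathbb R$, if $\epsilon=1$, respectively $z\sim(\cosh\theta,\sinh\theta)\cdot z$ if $\epsilon=-1$, with the metric that makes the projection a pseudo-Riemannian submersion. These spaces include $\mathbb{CP}^n_{p,c}$ ($\epsilon=1$; in particular $\mathbb{CP}^n$ and $\mathbb{CH}^n$), the para-complex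 space form $\mathbb{DP}^n$ ($\epsilon=-1$, $p=0$, $c=-1$) and its polar space ($\epsilon=-1$, $p=0$, $c=1$). -/

import Mathlib

open scoped Manifold ContDiff Topology

noncomputable section

/-! ## Tensor fields on manifolds and their coordinate expressions

All manifolds are modelled on a finite-dimensional real vector space `E`; a chart of `M` is an
element `ψ : OpenPartialHomeomorph M E` of the maximal smooth atlas. -/

namespace PseudoRiem

section Fields

variable {E : Type*} [NormedAddCommGroup E] [NormedSpace ℝ E]
  {M : Type*} [TopologicalSpace M] [ChartedSpace E M]

variable (E M) in
/-- Covariant 2-tensor fields (no regularity). -/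
abbrev BilinField := ∀ x : M,
  TangentSpace 𝓘(ℝ, E) x →L[ℝ] TangentSpace 𝓘(ℝ, E) x →L[ℝ] ℝ

variable (E M) in
/-- Fields of endomorphisms of the tangent spaces, i.e. (1,1)-tensor fields (no regularity). -/
abbrev EndField := ∀ x : M, TangentSpace 𝓘(ℝ, E) x →L[ℝ] TangentSpace 𝓘(ℝ, E) x

variable (E M) in
/-- The smooth charts of `M`. -/
abbrev smoothCharts : Set (OpenPartialHomeomorph M E) :=
  IsManifold.maximalAtlas 𝓘(ℝ, E) ∞ M

/-- The matrix `g_{ij}` of `g` in the chart `ψ`, as a function of the coordinates `y`. -/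
def BilinField.inChart (g : BilinField E M) (ψ : OpenPartialHomeomorph M E) (y : E) :
    E →L[ℝ] E →L[ℝ] ℝ :=
  ContinuousLinearMap.bilinearComp (E := E) (F := E) (E' := E) (F' := E) (g (ψ.symm y))
    (mfderiv 𝓘(ℝ, E) 𝓘(ℝ, E) ψ.symm y) (mfderiv 𝓘(ℝ, E) 𝓘(ℝ, E) ψ.symm y)

/-- The matrix `T^i_j` of `T` in the chart `ψ`, as a function of the coordinates `y`. -/
def EndField.inChart (T : EndField E M) (ψ : OpenPartialHomeomorph M E) (y : E) : E →L[ℝ] E :=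
  (mfderiv 𝓘(ℝ, E) 𝓘(ℝ, E) ψ (ψ.symm y)).comp
    ((T (ψ.symm y)).comp (mfderiv 𝓘(ℝ, E) 𝓘(ℝ, E) ψ.symm y))

/-- `g` is a pseudo-Riemannian metric (of arbitrary signature). -/
structure IsPseudoRiemannianMetric (g : BilinField E M) : Prop where
  symm : ∀ x u v, g x u v = g x v u
  nondegenerate : ∀ x u, (∀ v, g x u v = 0) → u = 0
  smooth : ∀ ψ ∈ smoothCharts E M, ContDiffOn ℝ ∞ (g.inChart ψ) ψ.target

end Fields

/-! ## Levi-Civita connection and curvature in coordinates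

Here `G : E → (E →L[ℝ] E →L[ℝ] ℝ)` is the coordinate expression of a metric. -/

section Coordinates

variable {E : Type*} [NormedAddCommGroup E] [NormedSpace ℝ E]

/-- The Christoffel symbols of the first kind, as a linear form in `w`:
`½ (∂_u G(v,w) + ∂_v G(u,w) - ∂_w G(u,v))`. -/
def christoffelFirst (G : E → E →L[ℝ] E →L[ℝ] ℝ) (y u v : E) : E →L[ℝ] ℝ :=
  (1 / 2 : ℝ) • (fderiv ℝ G y u v + fderiv ℝ G y v u - ((fderiv ℝ G y).flip u).flip v)

/-- The Christoffel symbols of the second kind: `Γ(u,v) = Γ^k_{ij} u^i v^j`, characterised by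
`G(Γ(u,v), w) = ½ (∂_u G(v,w) + ∂_v G(u,w) - ∂_w G(u,v))`. -/
def christoffel (G : E → E →L[ℝ] E →L[ℝ] ℝ) (y u v : E) : E :=
  (G y).inverse (christoffelFirst G y u v)

/-- The curvature operator
`R(u,v)w = ∇_u ∇_v w - ∇_v ∇_u w` (for `u`, `v`, `w` constant in coordinates). -/
def curvature (G : E → E →L[ℝ] E →L[ℝ] ℝ) (y u v w : E) : E :=
  fderiv ℝ (fun z => christoffel G z v w) y u - fderiv ℝ (fun z => christoffel G z u w) y v
    + christoffel G y u (christoffel G y v w) - christoffel G y v (christoffel G y u w)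

/-- The covariant derivative `(∇_u T) v` of a field of endomorphisms. -/
def covDerivEnd (G : E → E →L[ℝ] E →L[ℝ] ℝ) (T : E → E →L[ℝ] E) (y u v : E) : E :=
  fderiv ℝ T y u v + christoffel G y u (T y v) - T y (christoffel G y u v)

end Coordinates

/-! ## Abstract complex and para-complex space forms -/

section SpaceForm

variable {E : Type*} [NormedAddCommGroup E] [NormedSpace ℝ E]
  {M : Type*} [TopologicalSpace M] [ChartedSpace E M]

/-- The coordinate expression of the 2-form `ω = ⟨J·, ·⟩`. -/
def fundamentalForm (g : BilinField E M) (J : EndField E M) (ψ : OpenPartialHomeomorph M E)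
    (y : E) : E →L[ℝ] E →L[ℝ] ℝ :=
  (g.inChart ψ y).comp (J.inChart ψ y)

/-- The right-hand side `c (ε u ∧ v + Ju ∧ Jv + 2 ⟨u, Jv⟩ J) w` of the curvature equation of a
space form, where `(u ∧ v) w = ⟨v,w⟩ u - ⟨u,w⟩ v`. -/
def modelCurvature (ε : ℤˣ) (c : ℝ) (G : E →L[ℝ] E →L[ℝ] ℝ) (J : E →L[ℝ] E) (u v w : E) : E :=
  c • (((ε : ℤ) : ℝ) • (G v w • u - G u w • v) + (G (J v) w • J u - G (J u) w • J v)
    + (2 * G u (J v)) • J w)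

/-- `(M, g, J)` is a pseudo-Riemannian complex (`ε = 1`) or para-complex (`ε = -1`) space form
of holomorphic or para-holomorphic curvature `4c`:
`J² = -ε Id`, `⟨J·, J·⟩ = ε ⟨·,·⟩`, the form `ω = ⟨J·,·⟩` is closed, and
`R(X,Y) = c (ε X ∧ Y + JX ∧ JY + 2 ⟨X, JY⟩ J)` with `(X ∧ Y) Z = ⟨Y,Z⟩ X - ⟨X,Z⟩ Y`. -/
structure IsSpaceForm (ε : ℤˣ) (c : ℝ) (g : BilinField E M) (J : EndField E M) : Prop where
  metric : IsPseudoRiemannianMetric g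
  smooth_J : ∀ ψ ∈ smoothCharts E M, ContDiffOn ℝ ∞ (J.inChart ψ) ψ.target
  J_J : ∀ x u, J x (J x u) = -((ε : ℤ) : ℝ) • u
  compatible : ∀ x u v, g x (J x u) (J x v) = ((ε : ℤ) : ℝ) * g x u v
  closed : ∀ ψ ∈ smoothCharts E M, ∀ y ∈ ψ.target, ∀ u v w : E,
    fderiv ℝ (fundamentalForm g J ψ) y u v w - fderiv ℝ (fundamentalForm g J ψ) y v u w
      + fderiv ℝ (fundamentalForm g J ψ) y w u v = 0
  curvature_eq : ∀ ψ ∈ smoothCharts E M, ∀ y ∈ ψ.target, ∀ u v w : E,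
    curvature (g.inChart ψ) y u v w =
      modelCurvature ε c (g.inChart ψ y) (J.inChart ψ y) u v w

end SpaceForm

/-! ## Real hypersurfaces -/

section Hypersurface

variable {E : Type*} [NormedAddCommGroup E] [NormedSpace ℝ E]
  {M : Type*} [TopologicalSpace M] [ChartedSpace E M]
  {F : Type*} [NormedAddCommGroup F] [NormedSpace ℝ F]
  {S : Type*} [TopologicalSpace S] [ChartedSpace F S]

/-- The metric induced on `S` by a map `f : S → M`. -/
def induced (g : BilinField E M) (f : S → M) : BilinField F S := fun p =>
  ContinuousLinearMap.bilinearComp (E := E) (F := E) (E' := F) (F' := F) (g (f p))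
    (mfderiv 𝓘(ℝ, F) 𝓘(ℝ, E) f p) (mfderiv 𝓘(ℝ, F) 𝓘(ℝ, E) f p)

variable (F) in
/-- `f : S → M` is an immersed real hypersurface whose induced metric is non-degenerate. -/
structure IsNondegenerateHypersurface (g : BilinField E M) (f : S → M) : Prop where
  codim_one : Module.finrank ℝ E = Module.finrank ℝ F + 1
  smooth : ContMDiff 𝓘(ℝ, F) 𝓘(ℝ, E) ∞ f
  immersion : ∀ p, Function.Injective (mfderiv 𝓘(ℝ, F) 𝓘(ℝ, E) f p)
  nondegenerate : ∀ p (u : TangentSpace 𝓘(ℝ, F) p), (∀ v, induced (F := F) g f p u v = 0) → u = 0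

variable (E) in
/-- Vector fields of the ambient manifold along `f` (no regularity). -/
abbrev FieldAlong (f : S → M) := ∀ p : S, TangentSpace 𝓘(ℝ, E) (f p)

/-- The coordinate expression of a field along `f`, in a chart `φ` of `S` and a chart `ψ` of
`M`. -/
def FieldAlong.inChart {f : S → M} (N : FieldAlong E f) (φ : OpenPartialHomeomorph S F)
    (ψ : OpenPartialHomeomorph M E) (y : F) : E :=
  mfderiv 𝓘(ℝ, E) 𝓘(ℝ, E) ψ (f (φ.symm y)) (N (φ.symm y))

/-- The coordinates `φ(p)` of the points `p ∈ U` at which `φ` and `ψ` can be used. -/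
def chartDomain (f : S → M) (U : Set S) (φ : OpenPartialHomeomorph S F)
    (ψ : OpenPartialHomeomorph M E) : Set F :=
  φ.target ∩ φ.symm ⁻¹' (U ∩ f ⁻¹' ψ.source)

/-- The Levi-Civita covariant derivative `∇_u N` of a field `N` along `f`, in coordinates. -/
def covDerivAlong (g : BilinField E M) {f : S → M} (N : FieldAlong E f)
    (φ : OpenPartialHomeomorph S F) (ψ : OpenPartialHomeomorph M E) (y u : F) : E :=
  fderiv ℝ (N.inChart φ ψ) y u +
    christoffel (g.inChart ψ) (ψ (f (φ.symm y)))
      (fderiv ℝ (ψ ∘ f ∘ φ.symm) y u) (N.inChart φ ψ y)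

variable (F) in
/-- `N` is a smooth unit normal vector field along `f` on `U`; `⟨N, N⟩ = ±1`. -/
structure IsUnitNormalOn (g : BilinField E M) {f : S → M} (N : FieldAlong E f) (U : Set S) :
    Prop where
  smooth : ∀ φ ∈ smoothCharts F S, ∀ ψ ∈ smoothCharts E M,
    ContDiffOn ℝ ∞ (N.inChart φ ψ) (chartDomain f U φ ψ)
  normal : ∀ p ∈ U, ∀ u, g (f p) (N p) (mfderiv 𝓘(ℝ, F) 𝓘(ℝ, E) f p u) = 0
  unit : ∀ p ∈ U, g (f p) (N p) (N p) = 1 ∨ g (f p) (N p) (N p) = -1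

/-- `A` is the shape operator of `f` on `U` with respect to `N`: `∇_X N = -AX`. -/
def IsShapeOperatorOn (g : BilinField E M) {f : S → M} (N : FieldAlong E f)
    (A : EndField F S) (U : Set S) : Prop :=
  ∀ φ ∈ smoothCharts F S, ∀ ψ ∈ smoothCharts E M, ∀ y ∈ chartDomain f U φ ψ, ∀ u : F,
    covDerivAlong g N φ ψ y u = -fderiv ℝ (ψ ∘ f ∘ φ.symm) y (A.inChart φ y u)

variable (F) in
/-- The hypersurface `f` is umbilic: around each point, with respect to a local unit normal field,
the shape operator is `A = λ Id` for a smooth function `λ`. -/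
def IsUmbilic (g : BilinField E M) (f : S → M) : Prop :=
  ∀ p : S, ∃ U : Set S, IsOpen U ∧ p ∈ U ∧ ∃ (N : FieldAlong E f) (A : EndField F S) (l : S → ℝ),
    IsUnitNormalOn F g N U ∧ IsShapeOperatorOn g N A U ∧
    ContMDiffOn 𝓘(ℝ, F) 𝓘(ℝ, ℝ) ∞ l U ∧ ∀ q ∈ U, ∀ u, A q u = l q • u

variable (F) in
/-- The hypersurface `f` has parallel shape operator: around each point, with respect to a local
unit normal field, `∇A = 0`, where `∇` is the Levi-Civita connection of the induced metric. -/
def HasParallelShapeOperator (g : BilinField E M) (f : S → M) : Prop :=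
  ∀ p : S, ∃ U : Set S, IsOpen U ∧ p ∈ U ∧ ∃ (N : FieldAlong E f) (A : EndField F S),
    IsUnitNormalOn F g N U ∧ IsShapeOperatorOn g N A U ∧
    ∀ φ ∈ smoothCharts F S, ∀ y ∈ φ.target ∩ φ.symm ⁻¹' U, ∀ u v : F,
      covDerivEnd ((induced (F := F) g f).inChart φ) (A.inChart φ) y u v = 0

end Hypersurface

end PseudoRiem

/-! ## The model spaces

`(ℝ × ℝ)` with the product `amul ε` is the algebra of complex (`ε = 1`) or para-complex (`ε = -1`)
numbers, and `Amb n` is the corresponding space of `(n+1)`-tuples. -/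

namespace SpaceFormModel

/-- The real number `±1` given by a unit of `ℤ`. -/
def sgn (u : ℤˣ) : ℝ := ((u : ℤ) : ℝ)

lemma sgn_eq (u : ℤˣ) : (u = 1 ∧ sgn u = 1) ∨ (u = -1 ∧ sgn u = -1) := by
  rcases Int.units_eq_one_or u with rfl | rfl <;> simp [sgn]

lemma sgn_sq (u : ℤˣ) : sgn u * sgn u = 1 := by
  rcases sgn_eq u with h | h <;> simp [h.2]

/-- The product of two complex (`ε = 1`) or para-complex (`ε = -1`) numbers. -/
def amul (ε : ℤˣ) (a b : ℝ × ℝ) : ℝ × ℝ :=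
  (a.1 * b.1 - sgn ε * (a.2 * b.2), a.1 * b.2 + a.2 * b.1)

/-- The exponential of `θ` times the imaginary unit: `(cos θ, sin θ)` in the complex case,
`(cosh θ, sinh θ)` in the para-complex case. -/
def phase (ε : ℤˣ) (θ : ℝ) : ℝ × ℝ :=
  if ε = 1 then (Real.cos θ, Real.sin θ) else (Real.cosh θ, Real.sinh θ)

/-- `(n+1)`-tuples of complex or para-complex numbers. -/
abbrev Amb (n : ℕ) := Fin (n + 1) → ℝ × ℝ

/-- Multiplication of a tuple by a complex or para-complex number. -/
def act {n : ℕ} (ε : ℤˣ) (a : ℝ × ℝ) (z : Amb n) : Amb n := fun j => amul ε a (z j)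

/-- Multiplication of a tuple by the imaginary unit. -/
def J {n : ℕ} (ε : ℤˣ) (z : Amb n) : Amb n := act ε (0, 1) z

/-- The coefficients of the metric of `Amb n`: `p` times `-1`, then `+1`. -/
def coeff (p j : ℕ) : ℝ := if j < p then -1 else 1

/-- The flat metric `- ∑_{j < p} (dx_j² + ε dy_j²) + ∑_{j ≥ p} (dx_j² + ε dy_j²)`. -/
def form {n : ℕ} (p : ℕ) (ε : ℤˣ) (z w : Amb n) : ℝ :=
  ∑ j : Fin (n + 1), coeff p j * ((z j).1 * (w j).1 + sgn ε * ((z j).2 * (w j).2))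

/-- The hyperquadric `⟨z, z⟩ = c`, `c = ±1`. -/
abbrev Quadric (n p : ℕ) (ε c : ℤˣ) := {z : Amb n // form p ε z z = sgn c}

section algebra

variable {n p : ℕ} {ε c : ℤˣ}

/-- The square of the modulus of a complex or para-complex number. -/
def nsq (ε : ℤˣ) (a : ℝ × ℝ) : ℝ := a.1 * a.1 + sgn ε * (a.2 * a.2)

/-- The conjugate. -/
def conj (a : ℝ × ℝ) : ℝ × ℝ := (a.1, -a.2)

lemma form_add_left (z z' w : Amb n) : form p ε (z + z') w = form p ε z w + form p ε z' w := by
  simp only [form, ← Finset.sum_add_distrib]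
  exact Finset.sum_congr rfl fun j _ => by simp; ring

lemma form_smul_left (r : ℝ) (z w : Amb n) : form p ε (r • z) w = r * form p ε z w := by
  simp only [form, Finset.mul_sum]
  exact Finset.sum_congr rfl fun j _ => by simp; ring

lemma form_comm (z w : Amb n) : form p ε z w = form p ε w z := by
  simp only [form]
  exact Finset.sum_congr rfl fun j _ => by ring

lemma form_add_right (z w w' : Amb n) : form p ε z (w + w') = form p ε z w + form p ε z w' := by
  rw [form_comm, form_add_left, form_comm w, form_comm w']

lemma form_smul_right (r : ℝ) (z w : Amb n) : form p ε z (r • w) = r * form p ε z w := by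
  rw [form_comm, form_smul_left, form_comm]

lemma form_act_act (a : ℝ × ℝ) (z w : Amb n) :
    form p ε (act ε a z) (act ε a w) = nsq ε a * form p ε z w := by
  simp only [form, Finset.mul_sum]
  refine Finset.sum_congr rfl fun j _ => ?_
  have h := sgn_sq ε
  simp only [act, amul, nsq]
  ring

lemma form_act_left (a : ℝ × ℝ) (z w : Amb n) :
    form p ε (act ε a z) w = a.1 * form p ε z w - a.2 * form p ε z (J ε w) := by
  simp only [form, Finset.mul_sum, ← Finset.sum_sub_distrib]
  refine Finset.sum_congr rfl fun j _ => ?_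
  simp only [act, amul, J]
  ring

lemma form_J_J (z w : Amb n) : form p ε (J ε z) (J ε w) = sgn ε * form p ε z w := by
  rw [J, J, form_act_act]; simp [nsq]

lemma form_J_self (z : Amb n) : form p ε z (J ε z) = 0 := by
  simp only [form]
  refine Finset.sum_eq_zero fun j _ => ?_
  simp only [act, amul, J]
  ring

lemma act_act (a b : ℝ × ℝ) (z : Amb n) : act ε a (act ε b z) = act ε (amul ε a b) z := by
  funext j
  simp only [act, amul]
  ext <;> simp <;> ring

lemma act_real (r : ℝ) (z : Amb n) : act ε (r, 0) z = r • z := by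
  funext j
  simp only [act, amul]
  ext <;> simp

lemma act_eq (a : ℝ × ℝ) (z : Amb n) : act ε a z = a.1 • z + a.2 • J ε z := by
  funext j
  ext <;> simp [act, amul, J] <;> ring

lemma conj_mul (a : ℝ × ℝ) : amul ε (conj a) a = (nsq ε a, 0) := by
  simp only [amul, conj, nsq]
  ext <;> simp <;> ring

lemma nsq_mul (a b : ℝ × ℝ) : nsq ε (amul ε a b) = nsq ε a * nsq ε b := by
  have h := sgn_sq ε
  simp only [amul, nsq]
  ring

lemma nsq_phase (θ : ℝ) : nsq ε (phase ε θ) = 1 := by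
  rcases sgn_eq ε with ⟨rfl, h⟩ | ⟨rfl, h⟩
  · have := Real.cos_sq_add_sin_sq θ
    simp only [nsq, phase, h, if_true]; linarith
  · have := Real.cosh_sq_sub_sinh_sq θ
    rw [nsq, phase, h, if_neg (by decide)]; linarith

lemma phase_add (θ θ' : ℝ) : amul ε (phase ε θ) (phase ε θ') = phase ε (θ + θ') := by
  rcases sgn_eq ε with ⟨rfl, h⟩ | ⟨rfl, h⟩
  · simp only [amul, phase, h, if_true, Real.cos_add, Real.sin_add]
    ext <;> simp <;> ring
  · simp only [amul, phase, h, if_neg (show (-1 : ℤˣ) ≠ 1 by decide), Real.cosh_add, Real.sinh_add]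
    ext <;> simp <;> ring

lemma phase_zero : phase ε 0 = (1, 0) := by simp [phase]

/-- The numbers of modulus `1` (with positive real part in the para-complex case) are the
phases. -/
lemma exists_phase (a : ℝ × ℝ) (h1 : nsq ε a = 1) (h2 : ε = 1 ∨ 0 < a.1) :
    ∃ θ, phase ε θ = a := by
  obtain ⟨x, y⟩ := a
  rcases sgn_eq ε with ⟨rfl, h⟩ | ⟨rfl, h⟩
  · simp only [nsq, h] at h1
    have hx : ‖(⟨x, y⟩ : ℂ)‖ = 1 := by
      rw [Complex.norm_def, Complex.normSq_apply, Real.sqrt_eq_one]; simp; linarith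
    have hne : (⟨x, y⟩ : ℂ) ≠ 0 := fun h0 => by simp [h0] at hx
    refine ⟨Complex.arg ⟨x, y⟩, ?_⟩
    simp [phase, Complex.cos_arg hne, Complex.sin_arg, hx]
  · have h2 : 0 < x := h2.resolve_left (by decide)
    simp only [nsq, h] at h1
    refine ⟨Real.arsinh y, ?_⟩
    rw [phase, if_neg (by decide), Real.sinh_arsinh, Real.cosh_arsinh]
    have : 1 + y ^ 2 = x ^ 2 := by linarith
    rw [this, Real.sqrt_sq h2.le]

/-- `z ∼ z'` if `z' = exp(θ) z` for some phase. -/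
instance orbitSetoid (n p : ℕ) (ε c : ℤˣ) : Setoid (Quadric n p ε c) where
  r z z' := ∃ θ : ℝ, z'.1 = act ε (phase ε θ) z.1
  iseqv := by
    refine ⟨fun z => ⟨0, ?_⟩, ?_, ?_⟩
    · rw [phase_zero, act_real, one_smul]
    · rintro z z' ⟨θ, h⟩
      refine ⟨-θ, ?_⟩
      rw [h, act_act, phase_add, neg_add_cancel, phase_zero, act_real, one_smul]
    · rintro z z' z'' ⟨θ, h⟩ ⟨θ', h'⟩
      exact ⟨θ' + θ, by rw [h', h, act_act, phase_add]⟩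

end algebra

/-- The pseudo-Riemannian complex space form (`ε = 1`), or the para-complex space form (`ε = -1`):
the quotient of the hyperquadric by the relation `∼`, with the quotient topology. -/
def SpaceForm (n p : ℕ) (ε c : ℤˣ) := Quotient (orbitSetoid n p ε c)

instance (n p : ℕ) (ε c : ℤˣ) : TopologicalSpace (SpaceForm n p ε c) :=
  inferInstanceAs (TopologicalSpace (Quotient (orbitSetoid n p ε c)))

/-- The canonical projection. -/
def proj {n p : ℕ} {ε c : ℤˣ} (z : Quadric n p ε c) : SpaceForm n p ε c := Quotient.mk _ z

/-! ### The smooth structure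

The chart centred at `z₀` is the inverse of `w ↦ [√(1 - c ⟨w,w⟩) z₀ + w]`, where `w` is
orthogonal to `z₀` and `J z₀`. -/

section charts

variable {n p : ℕ} {ε c : ℤˣ}

/-- The (para-)complex coefficient `a` of `z` in the orthogonal decomposition
`z = a z₀ + h`. -/
def coef (z₀ : Quadric n p ε c) (z : Amb n) : ℝ × ℝ :=
  (sgn c * form p ε z z₀.1, sgn ε * sgn c * form p ε z (J ε z₀.1))

/-- The space orthogonal to `z` and `J z`; for `z` in the hyperquadric, this is the horizontal
subspace of the tangent space. -/
def horizontal (p : ℕ) (ε : ℤˣ) (z : Amb n) : Submodule ℝ (Amb n) where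
  carrier := {h | form p ε h z = 0 ∧ form p ε h (J ε z) = 0}
  add_mem' ha hb := ⟨by rw [form_add_left, ha.1, hb.1, add_zero],
    by rw [form_add_left, ha.2, hb.2, add_zero]⟩
  zero_mem' := ⟨by simp [form], by simp [form]⟩
  smul_mem' r h hh := ⟨by rw [form_smul_left, hh.1, mul_zero],
    by rw [form_smul_left, hh.2, mul_zero]⟩

lemma coef_act (z₀ : Quadric n p ε c) (a : ℝ × ℝ) (z : Amb n) :
    coef z₀ (act ε a z) = amul ε a (coef z₀ z) := by
  have h := sgn_sq ε
  have hJ : J ε (J ε z₀.1) = (-sgn ε) • z₀.1 := by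
    rw [J, J, act_act, ← act_real (ε := ε)]; congr 1; simp [amul]
  simp only [coef, form_act_left, amul, hJ, form_smul_right]
  ext
  · simp only; linear_combination (sgn c * a.2 * form p ε z (J ε z₀.1)) * h
  · simp only; linear_combination (sgn c * a.2 * form p ε z z₀.1) * h

lemma coef_add (z₀ : Quadric n p ε c) (z w : Amb n) :
    coef z₀ (z + w) = coef z₀ z + coef z₀ w := by
  simp only [coef, form_add_left]; ext <;> simp <;> ring

lemma coef_smul (z₀ : Quadric n p ε c) (r : ℝ) (z : Amb n) :
    coef z₀ (r • z) = r • coef z₀ z := by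
  simp only [coef, form_smul_left]; ext <;> simp <;> ring

lemma coef_self (z₀ : Quadric n p ε c) : coef z₀ z₀.1 = (1, 0) := by
  simp [coef, form_J_self, z₀.2, sgn_sq]

lemma coef_horizontal (z₀ : Quadric n p ε c) (h : Amb n) (hh : h ∈ horizontal p ε z₀.1) :
    coef z₀ h = 0 := by
  simp [coef, hh.1, hh.2]

lemma sub_mem (z₀ : Quadric n p ε c) (z : Amb n) :
    z - act ε (coef z₀ z) z₀.1 ∈ horizontal p ε z₀.1 := by
  have h1 := sgn_sq ε
  have h2 := sgn_sq c
  have hz := z₀.2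
  have key : coef z₀ (z - act ε (coef z₀ z) z₀.1) = 0 := by
    rw [sub_eq_add_neg, ← neg_one_smul ℝ, coef_add, coef_smul, coef_act, coef_self]
    ext <;> simp [amul]
  have ne (u : ℤˣ) : sgn u ≠ 0 := fun h => by simpa [h] using sgn_sq u
  have k1 := congrArg Prod.fst key
  have k2 := congrArg Prod.snd key
  simp only [coef, Prod.fst_zero, Prod.snd_zero] at k1 k2
  exact ⟨(mul_eq_zero.1 k1).resolve_left (ne c),
    (mul_eq_zero.1 k2).resolve_left (mul_ne_zero (ne ε) (ne c))⟩

/-- The orthogonal projection onto the horizontal subspace. -/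
def horProj (z₀ : Quadric n p ε c) : Amb n →ₗ[ℝ] horizontal p ε z₀.1 where
  toFun z := ⟨z - act ε (coef z₀ z) z₀.1, sub_mem z₀ z⟩
  map_add' z w := by
    ext1; simp only [coef_add, act_eq, Submodule.coe_add, Prod.fst_add, Prod.snd_add]; module
  map_smul' r z := by
    ext1
    simp only [coef_smul, act_eq, Submodule.coe_smul, Prod.smul_fst, Prod.smul_snd, smul_eq_mul,
      RingHom.id_apply]
    module

lemma horProj_horizontal (z₀ : Quadric n p ε c) (h : horizontal p ε z₀.1) :
    horProj z₀ h.1 = h := by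
  ext1
  simp [horProj, coef_horizontal z₀ h.1 h.2, act_eq]

lemma finrank_horizontal (z₀ : Quadric n p ε c) :
    Module.finrank ℝ (horizontal p ε z₀.1) = 2 * n := by
  let C : Amb n →ₗ[ℝ] ℝ × ℝ :=
    { toFun := coef z₀, map_add' := coef_add z₀, map_smul' := coef_smul z₀ }
  have hsurj : LinearMap.range C = ⊤ := by
    rw [LinearMap.range_eq_top]
    intro a
    refine ⟨act ε a z₀.1, ?_⟩
    change coef z₀ _ = a
    rw [coef_act, coef_self]; ext <;> simp [amul]
  have hker : LinearMap.ker C = horizontal p ε z₀.1 := by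
    ext h
    constructor
    · intro hh
      have hh : coef z₀ h = 0 := hh
      have := sub_mem z₀ h
      rwa [hh, act_eq, Prod.fst_zero, Prod.snd_zero, zero_smul, zero_smul, add_zero,
        sub_zero] at this
    · exact fun hh => coef_horizontal z₀ h hh
  have := C.finrank_range_add_finrank_ker
  rw [hsurj, hker, finrank_top] at this
  simp [Module.finrank_pi_fintype] at this
  omega

/-- The model vector space of the charts. -/
abbrev Mod (n : ℕ) := EuclideanSpace ℝ (Fin (2 * n))

/-- An identification of the horizontal subspace at `z₀` with the model space. -/
def iso (z₀ : Quadric n p ε c) : horizontal p ε z₀.1 ≃L[ℝ] Mod n :=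
  ContinuousLinearEquiv.ofFinrankEq (by rw [finrank_horizontal]; simp)

/-- Orthogonal projection followed by the identification. -/
def toMod (z₀ : Quadric n p ε c) : Amb n →L[ℝ] Mod n :=
  (iso z₀ : horizontal p ε z₀.1 →L[ℝ] Mod n).comp (LinearMap.toContinuousLinearMap (horProj z₀))

/-- The identification of the model space with a subspace of the ambient space. -/
def ofMod (z₀ : Quadric n p ε c) : Mod n →L[ℝ] Amb n :=
  (horizontal p ε z₀.1).subtypeL.comp ((iso z₀).symm : Mod n →L[ℝ] horizontal p ε z₀.1)

lemma ofMod_mem (z₀ : Quadric n p ε c) (y : Mod n) : ofMod z₀ y ∈ horizontal p ε z₀.1 :=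
  ((iso z₀).symm y).2

lemma toMod_ofMod (z₀ : Quadric n p ε c) (y : Mod n) : toMod z₀ (ofMod z₀ y) = y := by
  simp [toMod, ofMod, horProj_horizontal]

lemma ofMod_toMod (z₀ : Quadric n p ε c) (z : Amb n) :
    ofMod z₀ (toMod z₀ z) = z - act ε (coef z₀ z) z₀.1 := by
  simp [toMod, ofMod, horProj]

/-- The square of the coefficient of `z₀` in `√(1 - c ⟨w,w⟩) z₀ + w`. -/
def radicand (z₀ : Quadric n p ε c) (y : Mod n) : ℝ :=
  1 - sgn c * form p ε (ofMod z₀ y) (ofMod z₀ y)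

/-- The lift `√(1 - c ⟨w,w⟩) z₀ + w` of the point of coordinates `y`. -/
def lift (z₀ : Quadric n p ε c) (y : Mod n) : Amb n :=
  √(radicand z₀ y) • z₀.1 + ofMod z₀ y

lemma lift_mem (z₀ : Quadric n p ε c) (y : Mod n) (hy : 0 ≤ radicand z₀ y) :
    form p ε (lift z₀ y) (lift z₀ y) = sgn c := by
  have h0 := (ofMod_mem z₀ y).1
  have h0' := h0
  rw [form_comm] at h0'
  have hs := Real.mul_self_sqrt hy
  have h2 := sgn_sq c
  simp only [lift, form_add_left, form_add_right, form_smul_left, form_smul_right, h0, h0', z₀.2]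
  rw [radicand] at hs
  rw [radicand]
  linear_combination (sgn c) * hs - form p ε (ofMod z₀ y) (ofMod z₀ y) * h2

/-- The coordinates of the class of `z`: if `z = a z₀ + h`, they correspond to the horizontal part
of `(ā / |a|) z`. -/
def coord (z₀ : Quadric n p ε c) (z : Amb n) : Mod n :=
  (√(nsq ε (coef z₀ z)))⁻¹ • toMod z₀ (act ε (conj (coef z₀ z)) z)

/-- The points `z = a z₀ + h` such that `|a|² > 0`, and `a` has positive real part in the
para-complex case. -/
def dom (z₀ : Quadric n p ε c) : Set (Amb n) :=
  {z | 0 < nsq ε (coef z₀ z) ∧ (ε = 1 ∨ 0 < (coef z₀ z).1)}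

lemma coord_phase (z₀ : Quadric n p ε c) (θ : ℝ) (z : Amb n) :
    coord z₀ (act ε (phase ε θ) z) = coord z₀ z := by
  have h1 := nsq_phase (ε := ε) θ
  rw [coord, coord, coef_act, nsq_mul, h1, one_mul, act_act]
  congr 3
  generalize coef z₀ z = a
  rw [nsq] at h1
  ext
  · simp only [amul, conj]; linear_combination a.1 * h1
  · simp only [amul, conj]; linear_combination (-a.2) * h1

lemma dom_phase (z₀ : Quadric n p ε c) (θ : ℝ) (z : Amb n) (hz : z ∈ dom z₀) :
    act ε (phase ε θ) z ∈ dom z₀ := by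
  obtain ⟨h1, h2⟩ := hz
  refine ⟨by rw [coef_act, nsq_mul, nsq_phase, one_mul]; exact h1, ?_⟩
  rw [coef_act]
  generalize coef z₀ z = a at *
  rcases sgn_eq ε with ⟨rfl, h⟩ | ⟨rfl, h⟩
  · exact Or.inl rfl
  · right
    have h2 := h2.resolve_left (by decide)
    simp only [amul, phase, h, if_neg (show (-1 : ℤˣ) ≠ 1 by decide)]
    simp only [nsq, h] at h1
    have h3 : |a.2| < a.1 := abs_lt_of_sq_lt_sq (by nlinarith) h2.le
    have h4 : |Real.sinh θ| < Real.cosh θ :=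
      abs_lt_of_sq_lt_sq (by have := Real.cosh_sq_sub_sinh_sq θ; linarith) (Real.cosh_pos θ).le
    have h5 : |Real.sinh θ * a.2| ≤ Real.cosh θ * |a.2| := by
      rw [abs_mul]; gcongr
    have h6 : Real.cosh θ * |a.2| < Real.cosh θ * a.1 :=
      mul_lt_mul_of_pos_left h3 (Real.cosh_pos θ)
    have := neg_abs_le (Real.sinh θ * a.2)
    linarith

lemma lift_coef (z₀ : Quadric n p ε c) (y : Mod n) :
    coef z₀ (lift z₀ y) = (√(radicand z₀ y), 0) := by
  rw [lift, coef_add, coef_smul, coef_self, coef_horizontal z₀ _ (ofMod_mem z₀ y)]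
  simp

lemma lift_dom (z₀ : Quadric n p ε c) (y : Mod n) (hy : 0 < radicand z₀ y) :
    lift z₀ y ∈ dom z₀ := by
  have := Real.sqrt_pos.2 hy
  refine ⟨?_, Or.inr ?_⟩
  · rw [lift_coef]; simp only [nsq]; simp [hy]
  · rw [lift_coef]; exact this

lemma toMod_base (z₀ : Quadric n p ε c) : toMod z₀ z₀.1 = 0 := by
  have : horProj z₀ z₀.1 = 0 := by
    ext1; simp [horProj, coef_self, act_eq]
  simp [toMod, this]

lemma coord_lift (z₀ : Quadric n p ε c) (y : Mod n) (hy : 0 < radicand z₀ y) :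
    coord z₀ (lift z₀ y) = y := by
  have h := Real.sqrt_pos.2 hy
  have h2 := Real.mul_self_sqrt hy.le
  have h1 : nsq ε (√(radicand z₀ y), 0) = radicand z₀ y := by simp [nsq, h2]
  rw [coord, lift_coef, h1, conj, neg_zero, act_real, map_smul, smul_smul,
    inv_mul_cancel₀ h.ne', one_smul, lift, map_add, map_smul, toMod_base, toMod_ofMod]
  simp

lemma radicand_coord (z₀ z : Quadric n p ε c) (hz : z.1 ∈ dom z₀) :
    radicand z₀ (coord z₀ z.1) = nsq ε (coef z₀ z.1) ∧
      lift z₀ (coord z₀ z.1) =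
        act ε ((√(nsq ε (coef z₀ z.1)))⁻¹ • conj (coef z₀ z.1)) z.1 := by
  set a := coef z₀ z.1 with ha
  have hpos : 0 < nsq ε a := hz.1
  have hs := Real.mul_self_sqrt hpos.le
  have hs' := Real.sqrt_pos.2 hpos
  set s := √(nsq ε a) with hsdef
  have hof : ofMod z₀ (coord z₀ z.1) = s⁻¹ • act ε (conj a) z.1 - s • z₀.1 := by
    rw [coord, ← ha, ← hsdef, map_smul, ofMod_toMod, coef_act, ← ha, conj_mul, act_real, smul_sub,
      smul_smul, ← hs, inv_mul_cancel_left₀ hs'.ne']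
  have hnc : nsq ε (conj a) = nsq ε a := by simp [nsq, conj]
  have hc := sgn_sq c
  have hrad : radicand z₀ (coord z₀ z.1) = nsq ε a := by
    have h0 := (ofMod_mem z₀ (coord z₀ z.1)).1
    have e : s⁻¹ • act ε (conj a) z.1 = s • z₀.1 + ofMod z₀ (coord z₀ z.1) := by
      rw [hof]; abel
    have e2 : form p ε (s⁻¹ • act ε (conj a) z.1) (s⁻¹ • act ε (conj a) z.1) = sgn c := by
      rw [form_smul_left, form_smul_right, form_act_act, hnc, z.2, ← hs]
      field_simp
    have h0' := h0
    rw [form_comm] at h0'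
    rw [e, form_add_left, form_add_right, form_add_right, form_smul_left, form_smul_right,
      form_smul_left, form_smul_right, h0, h0', z₀.2] at e2
    rw [radicand]
    linear_combination (-sgn c) * e2 - (1 - s * s) * hc + hs
  refine ⟨hrad, ?_⟩
  rw [lift, hrad, ← hsdef, hof]
  have : act ε (s⁻¹ • conj a) z.1 = s⁻¹ • act ε (conj a) z.1 := by
    simp only [act_eq, Prod.smul_fst, Prod.smul_snd, smul_eq_mul, smul_add, smul_smul]
  rw [this]; abel

lemma proj_eq_iff (z z' : Quadric n p ε c) :
    proj z = proj z' ↔ ∃ θ : ℝ, z'.1 = act ε (phase ε θ) z.1 :=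
  Quotient.eq

lemma isQuotientMap_proj :
    Topology.IsQuotientMap (proj : Quadric n p ε c → SpaceForm n p ε c) :=
  isQuotientMap_quot_mk

lemma contDiff_form {V : Type*} [NormedAddCommGroup V] [NormedSpace ℝ V] {f g : V → Amb n}
    (hf : ContDiff ℝ ∞ f) (hg : ContDiff ℝ ∞ g) :
    ContDiff ℝ ∞ (fun y => form p ε (f y) (g y)) := by
  have hf' := contDiff_pi.1 hf
  have hg' := contDiff_pi.1 hg
  unfold form
  refine ContDiff.sum fun j _ => ?_
  have := hf' j
  have := hg' j
  fun_prop

lemma contDiff_coef (z₀ : Quadric n p ε c) : ContDiff ℝ ∞ (coef z₀) := by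
  unfold coef
  have h1 := contDiff_form (p := p) (ε := ε) contDiff_id (contDiff_const (c := z₀.1))
  have h2 := contDiff_form (p := p) (ε := ε) contDiff_id (contDiff_const (c := J ε z₀.1))
  exact (contDiff_const.mul h1).prodMk (contDiff_const.mul h2)

lemma contDiff_radicand (z₀ : Quadric n p ε c) : ContDiff ℝ ∞ (radicand z₀) := by
  unfold radicand
  have := contDiff_form (p := p) (ε := ε) (ofMod z₀).contDiff (ofMod z₀).contDiff
  exact contDiff_const.sub (contDiff_const.mul this)

lemma contDiffOn_lift (z₀ : Quadric n p ε c) :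
    ContDiffOn ℝ ∞ (lift z₀) {y | 0 < radicand z₀ y} := by
  intro y hy
  have h1 : ContDiffAt ℝ ∞ (fun y => √(radicand z₀ y)) y :=
    (contDiff_radicand z₀).contDiffAt.sqrt (ne_of_gt hy)
  exact ((h1.smul contDiffAt_const).add (ofMod z₀).contDiff.contDiffAt).contDiffWithinAt

lemma contDiff_nsq_coef (z₀ : Quadric n p ε c) :
    ContDiff ℝ ∞ (fun z => nsq ε (coef z₀ z)) := by
  have := contDiff_coef z₀
  have h1 : ContDiff ℝ ∞ (fun z => (coef z₀ z).1) := contDiff_fst.comp this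
  have h2 : ContDiff ℝ ∞ (fun z => (coef z₀ z).2) := contDiff_snd.comp this
  exact (h1.mul h1).add (contDiff_const.mul (h2.mul h2))

lemma contDiffOn_coord (z₀ : Quadric n p ε c) : ContDiffOn ℝ ∞ (coord z₀) (dom z₀) := by
  intro z hz
  have hc := contDiff_coef z₀
  have h1 : ContDiffAt ℝ ∞ (fun z => √(nsq ε (coef z₀ z))) z :=
    (contDiff_nsq_coef z₀).contDiffAt.sqrt (ne_of_gt hz.1)
  have h2 : ContDiff ℝ ∞ (fun z : Amb n => act ε (conj (coef z₀ z)) z) := by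
    refine contDiff_pi.2 fun j => ?_
    have k1 : ContDiff ℝ ∞ (fun z => (coef z₀ z).1) := contDiff_fst.comp hc
    have k2 : ContDiff ℝ ∞ (fun z => -(coef z₀ z).2) := (contDiff_snd.comp hc).neg
    have k3 : ContDiff ℝ ∞ (fun z : Amb n => (z j).1) := by fun_prop
    have k4 : ContDiff ℝ ∞ (fun z : Amb n => (z j).2) := by fun_prop
    exact ((k1.mul k3).sub (contDiff_const.mul (k2.mul k4))).prodMk
      ((k1.mul k4).add (k2.mul k3))
  exact ((h1.inv (Real.sqrt_pos.2 hz.1).ne').smul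
    ((toMod z₀).contDiff.comp h2).contDiffAt).contDiffWithinAt

lemma isOpen_dom (z₀ : Quadric n p ε c) : IsOpen (dom z₀) := by
  have h1 := (contDiff_nsq_coef z₀).continuous
  have h2 := (contDiff_coef z₀).continuous
  exact (isOpen_lt continuous_const h1).inter
    (isOpen_const.union (isOpen_lt continuous_const (continuous_fst.comp h2)))

lemma self_mem_dom (z₀ : Quadric n p ε c) : z₀.1 ∈ dom z₀ := by
  simp [dom, coef_self, nsq]

/-- The domain of the chart centred at `z₀`. -/
def chartSource (z₀ : Quadric n p ε c) : Set (SpaceForm n p ε c) := proj '' {z | z.1 ∈ dom z₀}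

lemma proj_mem_source (z₀ z : Quadric n p ε c) : proj z ∈ chartSource z₀ ↔ z.1 ∈ dom z₀ := by
  refine ⟨?_, fun h => ⟨z, h, rfl⟩⟩
  rintro ⟨z', hz', h⟩
  obtain ⟨θ, h⟩ := (proj_eq_iff _ _).1 h
  rw [h]
  exact dom_phase _ _ _ hz'

/-- The coordinates of a point of the quotient. -/
def chartFun (z₀ : Quadric n p ε c) : SpaceForm n p ε c → Mod n :=
  Quotient.lift (fun z => coord z₀ z.1) (by
    rintro z z' ⟨θ, h⟩
    rw [h, coord_phase])

open Classical in
/-- The inverse `y ↦ [√(1 - c ⟨w,w⟩) z₀ + w]` of the chart centred at `z₀`. -/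
def chartInv (z₀ : Quadric n p ε c) (y : Mod n) : SpaceForm n p ε c :=
  if hy : 0 ≤ radicand z₀ y then proj ⟨lift z₀ y, lift_mem z₀ y hy⟩ else proj z₀

lemma chartInv_of_pos (z₀ : Quadric n p ε c) (y : Mod n) (hy : 0 < radicand z₀ y) :
    chartInv z₀ y = proj ⟨lift z₀ y, lift_mem z₀ y hy.le⟩ := dif_pos hy.le

/-- The chart centred at `z₀`. -/
def chart (z₀ : Quadric n p ε c) : OpenPartialHomeomorph (SpaceForm n p ε c) (Mod n) where
  toFun := chartFun z₀
  invFun := chartInv z₀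
  source := chartSource z₀
  target := {y | 0 < radicand z₀ y}
  map_source' := by
    rintro _ ⟨z, hz, rfl⟩
    change 0 < radicand z₀ (coord z₀ z.1)
    rw [(radicand_coord z₀ z hz).1]
    exact hz.1
  map_target' := by
    intro y hy
    rw [chartInv_of_pos z₀ y hy, proj_mem_source]
    exact lift_dom z₀ y hy
  left_inv' := by
    rintro _ ⟨z, hz, rfl⟩
    change chartInv z₀ (coord z₀ z.1) = proj z
    have h := radicand_coord z₀ z hz
    have hz1 : 0 < nsq ε (coef z₀ z.1) := hz.1
    have hpos : 0 < radicand z₀ (coord z₀ z.1) := by rw [h.1]; exact hz1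
    rw [chartInv_of_pos z₀ _ hpos]
    symm
    rw [proj_eq_iff]
    obtain ⟨θ, hθ⟩ := exists_phase (ε := ε)
      ((√(nsq ε (coef z₀ z.1)))⁻¹ • conj (coef z₀ z.1)) (by
        have hs := Real.mul_self_sqrt hz1.le
        have hs' := Real.sqrt_pos.2 hz1
        have : nsq ε ((√(nsq ε (coef z₀ z.1)))⁻¹ • conj (coef z₀ z.1)) =
            (√(nsq ε (coef z₀ z.1)))⁻¹ * (√(nsq ε (coef z₀ z.1)))⁻¹ * nsq ε (coef z₀ z.1) := by
          simp only [nsq, conj, Prod.smul_mk, smul_eq_mul]; ring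
        rw [this, ← mul_inv, hs, inv_mul_cancel₀ hz1.ne'])
      (hz.2.imp id fun h => by
        have hs' := Real.sqrt_pos.2 hz1
        exact mul_pos (inv_pos.2 hs') h)
    exact ⟨θ, by rw [hθ]; exact h.2⟩
  right_inv' := by
    intro y hy
    rw [chartInv_of_pos z₀ y hy]
    exact coord_lift z₀ y hy
  open_source := by
    rw [← isQuotientMap_proj.isOpen_preimage]
    have : proj ⁻¹' chartSource z₀ = {z : Quadric n p ε c | z.1 ∈ dom z₀} := by
      ext z; exact proj_mem_source z₀ z
    rw [this]
    exact (isOpen_dom z₀).preimage continuous_subtype_val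
  open_target := isOpen_lt continuous_const (contDiff_radicand z₀).continuous
  continuousOn_toFun := by
    have ho : IsOpen (chartSource z₀) := by
      rw [← isQuotientMap_proj.isOpen_preimage]
      have : proj ⁻¹' chartSource z₀ = {z : Quadric n p ε c | z.1 ∈ dom z₀} := by
        ext z; exact proj_mem_source z₀ z
      rw [this]
      exact (isOpen_dom z₀).preimage continuous_subtype_val
    rw [isQuotientMap_proj.continuousOn_isOpen_iff ho]
    exact (contDiffOn_coord z₀).continuousOn.comp continuous_subtype_val.continuousOn
      fun z hz => (proj_mem_source z₀ z).1 hz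
  continuousOn_invFun := by
    rw [continuousOn_iff_continuous_domRestrict]
    have h : Continuous fun y : {y | 0 < radicand z₀ y} =>
        (⟨lift z₀ y.1, lift_mem z₀ y.1 y.2.le⟩ : Quadric n p ε c) :=
      Continuous.subtype_mk (continuousOn_iff_continuous_domRestrict.1
        (contDiffOn_lift z₀).continuousOn) _
    refine (isQuotientMap_proj.continuous.comp h).congr fun y => ?_
    exact (chartInv_of_pos z₀ y.1 y.2).symm

/-- A representative in the hyperquadric of a point of the quotient. -/
def rep (x : SpaceForm n p ε c) : Quadric n p ε c := Quotient.out x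

lemma proj_rep (x : SpaceForm n p ε c) : proj (rep x) = x := Quotient.out_eq x

instance : ChartedSpace (Mod n) (SpaceForm n p ε c) where
  atlas := Set.range chart
  chartAt x := chart (rep x)
  mem_chart_source x := by
    change x ∈ chartSource (rep x)
    have h : proj (rep x) ∈ chartSource (rep x) :=
      (proj_mem_source _ _).2 (self_mem_dom _)
    rwa [proj_rep] at h
  chart_mem_atlas x := ⟨rep x, rfl⟩

instance : IsManifold 𝓘(ℝ, Mod n) ∞ (SpaceForm n p ε c) := by
  apply isManifold_of_contDiffOn
  rintro _ _ ⟨z₁, rfl⟩ ⟨z₂, rfl⟩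
  have key : ContDiffOn ℝ ∞ (coord z₂ ∘ lift z₁)
      ({y | 0 < radicand z₁ y} ∩ lift z₁ ⁻¹' dom z₂) :=
    (contDiffOn_coord z₂).comp ((contDiffOn_lift z₁).mono Set.inter_subset_left)
      Set.inter_subset_right
  have hsub : ∀ y ∈ (𝓘(ℝ, Mod n)).symm ⁻¹' ((chart z₁).symm ≫ₕ chart z₂).source ∩
      Set.range 𝓘(ℝ, Mod n), 0 < radicand z₁ y ∧ lift z₁ y ∈ dom z₂ := by
    rintro y ⟨hy, -⟩
    rw [Set.mem_preimage, OpenPartialHomeomorph.trans_source] at hy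
    have h1 : 0 < radicand z₁ y := hy.1
    have h2 : chartInv z₁ y ∈ chartSource z₂ := hy.2
    rw [chartInv_of_pos z₁ y h1, proj_mem_source] at h2
    exact ⟨h1, h2⟩
  refine (key.mono hsub).congr fun y hy => ?_
  change chartFun z₂ (chartInv z₁ y) = _
  rw [chartInv_of_pos z₁ y (hsub y hy).1]
  rfl

end charts

/-! ### The metric of the model spaces -/

section metric

variable {n p : ℕ} {ε c : ℤˣ}

/-- The flat metric of the ambient space as a continuous bilinear form. -/
def formL (n p : ℕ) (ε : ℤˣ) : Amb n →L[ℝ] Amb n →L[ℝ] ℝ :=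
  (LinearMap.mk₂ ℝ (form p ε) form_add_left form_smul_left form_add_right
    form_smul_right).toContinuousBilinearMap

lemma normalize_mem (z : Amb n) (hz : 0 < sgn c * form p ε z z) :
    form p ε ((√(sgn c * form p ε z z))⁻¹ • z) ((√(sgn c * form p ε z z))⁻¹ • z) = sgn c := by
  have h := Real.mul_self_sqrt hz.le
  have h' := Real.sqrt_pos.2 hz
  have hc := sgn_sq c
  have e : form p ε z z = sgn c * (√(sgn c * form p ε z z) * √(sgn c * form p ε z z)) := by
    rw [h]; linear_combination (-form p ε z z) * hc
  rw [form_smul_left, form_smul_right]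
  set s := √(sgn c * form p ε z z)
  rw [e]
  field_simp

open Classical in
/-- The canonical projection, extended to a neighbourhood of the hyperquadric so as to be constant
on the half-lines through `0`. The value at the other points is arbitrary. -/
def coneProj (z₀ : Quadric n p ε c) (z : Amb n) : SpaceForm n p ε c :=
  if hz : 0 < sgn c * form p ε z z then
    proj ⟨(√(sgn c * form p ε z z))⁻¹ • z, normalize_mem z hz⟩
  else proj z₀

/-- The differential of the canonical projection at `z`. -/
def dproj (z : Quadric n p ε c) : Amb n →L[ℝ] Mod n :=
  mfderiv 𝓘(ℝ, Amb n) 𝓘(ℝ, Mod n) (coneProj z) z.1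

/-- The horizontal lift of tangent vectors at `x`, at a representative of `x`: the inverse of the
restriction of the differential of the projection to the horizontal subspace. -/
def horLift (x : SpaceForm n p ε c) : Mod n →L[ℝ] horizontal p ε (rep x).1 :=
  ((dproj (rep x)).comp (horizontal p ε (rep x).1).subtypeL).inverse

/-- The metric that makes the canonical projection a pseudo-Riemannian submersion. -/
def metric (n p : ℕ) (ε c : ℤˣ) : PseudoRiem.BilinField (Mod n) (SpaceForm n p ε c) := fun x =>
  ContinuousLinearMap.bilinearComp (E' := Mod n) (F' := Mod n) (formL n p ε)
    ((horizontal p ε (rep x).1).subtypeL.comp (horLift x))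
    ((horizontal p ε (rep x).1).subtypeL.comp (horLift x))

lemma coord_smul (z₀ : Quadric n p ε c) (r : ℝ) (hr : 0 < r) (z : Amb n) :
    coord z₀ (r • z) = r • coord z₀ z := by
  have h1 : nsq ε (coef z₀ (r • z)) = r ^ 2 * nsq ε (coef z₀ z) := by
    rw [coef_smul]; simp only [nsq, Prod.smul_fst, Prod.smul_snd, smul_eq_mul]; ring
  have h2 : act ε (conj (coef z₀ (r • z))) (r • z) = (r * r) • act ε (conj (coef z₀ z)) z := by
    rw [coef_smul]
    funext j
    ext <;> simp [act, amul, conj] <;> ring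
  rw [coord, coord, h1, h2, map_smul, smul_smul, smul_smul, Real.sqrt_mul (sq_nonneg r),
    Real.sqrt_sq hr.le]
  congr 1
  field_simp

lemma dproj_horizontal (z z' : Quadric n p ε c) (hz' : rep (proj z) = z') (θ : ℝ)
    (hθ : z'.1 = act ε (phase ε θ) z.1) (h : Amb n) (hh : h ∈ horizontal p ε z.1) :
    dproj z h = toMod z' (act ε (phase ε θ) h) := by
  have hc := sgn_sq c
  have hq : ContDiff ℝ ∞ (fun w : Amb n => sgn c * form p ε w w) :=
    contDiff_const.mul (contDiff_form contDiff_id contDiff_id)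
  have hq1 : sgn c * form p ε z.1 z.1 = 1 := by rw [z.2, hc]
  have hbase : coneProj z z.1 = proj z := by
    rw [coneProj, dif_pos (by rw [hq1]; exact one_pos)]
    congr 1; ext1; simp [hq1]
  have hpp : proj z' = proj z := by rw [← hz', proj_rep]
  have hdom : z.1 ∈ dom z' := by
    rw [← proj_mem_source, ← hpp, proj_mem_source]; exact self_mem_dom z'
  let Φ : Amb n → Mod n := fun w => coord z' ((√(sgn c * form p ε w w))⁻¹ • w)
  have hnorm : ContDiffAt ℝ ∞ (fun w : Amb n => (√(sgn c * form p ε w w))⁻¹ • w) z.1 := by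
    have h1 : ContDiffAt ℝ ∞ (fun w : Amb n => √(sgn c * form p ε w w)) z.1 :=
      hq.contDiffAt.sqrt (by rw [hq1]; exact one_ne_zero)
    exact (h1.inv (by rw [hq1]; simp)).smul contDiffAt_id
  have hnz : (√(sgn c * form p ε z.1 z.1))⁻¹ • z.1 = z.1 := by rw [hq1]; simp
  have hΦ : ContDiffAt ℝ ∞ Φ z.1 := by
    have h1 : ContDiffAt ℝ ∞ (coord z') ((√(sgn c * form p ε z.1 z.1))⁻¹ • z.1) := by
      rw [hnz]
      exact (contDiffOn_coord z').contDiffAt ((isOpen_dom z').mem_nhds hdom)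
    exact ContDiffAt.comp (g := coord z') z.1 h1 hnorm
  have hev : ∀ᶠ w in 𝓝 z.1, 0 < sgn c * form p ε w w ∧
      (√(sgn c * form p ε w w))⁻¹ • w ∈ dom z' := by
    refine Filter.Eventually.and ?_ ?_
    · exact hq.continuous.continuousAt.eventually
        (lt_mem_nhds (by beta_reduce; rw [hq1]; exact one_pos))
    · refine hnorm.continuousAt.eventually ?_
      beta_reduce; rw [hnz]; exact (isOpen_dom z').mem_nhds hdom
  have hΦeq : ∀ᶠ w in 𝓝 z.1, chartFun z' (coneProj z w) = Φ w := by
    filter_upwards [hev] with w hw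
    rw [coneProj, dif_pos hw.1]; rfl
  have hcone : ∀ᶠ w in 𝓝 z.1, coneProj z w = (chart z').symm (Φ w) := by
    filter_upwards [hev, hΦeq] with w hw hw'
    rw [← hw']
    refine ((chart z').left_inv ?_).symm
    change coneProj z w ∈ chartSource z'
    rw [coneProj, dif_pos hw.1, proj_mem_source]
    exact hw.2
  have hcont : ContinuousAt (coneProj z) z.1 := by
    refine ContinuousAt.congr ?_ (hcone.mono fun _ h => h.symm)
    refine ContinuousAt.comp ?_ hΦ.continuousAt
    refine (chart z').symm.continuousAt ?_
    change 0 < radicand z' (coord z' _)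
    rw [hnz, (radicand_coord z' z hdom).1]
    exact hdom.1
  have hchart : chartAt (Mod n) (coneProj z z.1) = chart z' := by
    change chart (rep (coneProj z z.1)) = _
    rw [hbase, hz']
  have hwr : writtenInExtChartAt 𝓘(ℝ, Amb n) 𝓘(ℝ, Mod n) z.1 (coneProj z) =ᶠ[𝓝 z.1] Φ := by
    filter_upwards [hΦeq] with w hw
    rw [← hw]
    simp only [writtenInExtChartAt, extChartAt, hchart]
    rfl
  have hmd : MDifferentiableAt 𝓘(ℝ, Amb n) 𝓘(ℝ, Mod n) (coneProj z) z.1 := by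
    rw [mdifferentiableAt_iff]
    refine ⟨hcont, ?_⟩
    simp only [modelWithCornersSelf_coe, Set.range_id, differentiableWithinAt_univ,
      extChartAt_model_space_eq_id, PartialEquiv.refl_coe, id]
    exact (hΦ.differentiableAt (by simp)).congr_of_eventuallyEq hwr
  have hd : dproj z = fderiv ℝ Φ z.1 := by
    have h1 : dproj z = fderivWithin ℝ
      (writtenInExtChartAt 𝓘(ℝ, Amb n) 𝓘(ℝ, Mod n) z.1 (coneProj z))
      (Set.range 𝓘(ℝ, Amb n)) ((extChartAt 𝓘(ℝ, Amb n) z.1) z.1) := by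
      unfold dproj
      rw [mfderiv]
      exact if_pos hmd
    rw [h1]
    simp only [modelWithCornersSelf_coe, Set.range_id, fderivWithin_univ,
      extChartAt_model_space_eq_id, PartialEquiv.refl_coe, id]
    exact hwr.fderiv_eq
  -- the derivative of `Φ` along the line `t ↦ z + t h`
  have hline : HasDerivAt (fun t : ℝ => Φ (z.1 + t • h)) (fderiv ℝ Φ z.1 h) 0 := by
    have h1 : HasDerivAt (fun t : ℝ => z.1 + t • h) h 0 := by
      simpa using ((hasDerivAt_id (0 : ℝ)).smul_const h).const_add z.1
    have h2 : HasFDerivAt Φ (fderiv ℝ Φ z.1) (z.1 + (0 : ℝ) • h) := by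
      simpa using (hΦ.differentiableAt (by simp)).hasFDerivAt
    exact h2.comp_hasDerivAt 0 h1
  set k := act ε (phase ε θ) h with hk
  have hkmem : coef z' k = 0 := by
    have hu := nsq_phase (ε := ε) θ
    have e1 : form p ε k z'.1 = 0 := by rw [hθ, hk, form_act_act, hh.1, mul_zero]
    have e2 : form p ε k (J ε z'.1) = 0 := by
      have : J ε z'.1 = act ε (phase ε θ) (J ε z.1) := by
        rw [hθ, J, J, act_act, act_act]; congr 1; simp [amul]
      rw [this, hk, form_act_act, hh.2, mul_zero]
    simp [coef, e1, e2]
  have hline2 : ∀ᶠ t : ℝ in 𝓝 0, Φ (z.1 + t • h) =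
      ((√(1 + sgn c * t ^ 2 * form p ε h h))⁻¹ * t) • toMod z' k := by
    have hct : Continuous fun t : ℝ => 1 + sgn c * t ^ 2 * form p ε h h := by fun_prop
    have hpos : ∀ᶠ t : ℝ in 𝓝 0, 0 < 1 + sgn c * t ^ 2 * form p ε h h :=
      hct.continuousAt.eventually (lt_mem_nhds (by simp))
    filter_upwards [hpos] with t ht
    have e0 : form p ε z.1 h = 0 := by rw [form_comm]; exact hh.1
    have e1 : sgn c * form p ε (z.1 + t • h) (z.1 + t • h) =
        1 + sgn c * t ^ 2 * form p ε h h := by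
      rw [form_add_left, form_add_right, form_add_right, form_smul_left, form_smul_right,
        form_smul_left, form_smul_right, e0, hh.1, z.2]
      linear_combination hc
    change coord z' _ = _
    rw [e1, coord_smul z' _ (inv_pos.2 (Real.sqrt_pos.2 ht)), ← smul_smul]
    congr 1
    rw [← coord_phase z' θ]
    have e2 : act ε (phase ε θ) (z.1 + t • h) = z'.1 + t • k := by
      rw [hθ, hk]; funext j; ext <;> simp [act, amul] <;> ring
    have e3 : coef z' (z'.1 + t • k) = (1, 0) := by
      rw [coef_add, coef_smul, hkmem, coef_self, smul_zero, add_zero]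
    have e4 : nsq ε ((1, 0) : ℝ × ℝ) = 1 := by simp [nsq]
    rw [e2, coord, e3, e4, conj, neg_zero, act_real, one_smul, map_add, map_smul, toMod_base]
    simp
  have hder : HasDerivAt (fun t : ℝ => ((√(1 + sgn c * t ^ 2 * form p ε h h))⁻¹ * t) •
      toMod z' k) (toMod z' k) 0 := by
    have h1 : DifferentiableAt ℝ (fun t : ℝ => (√(1 + sgn c * t ^ 2 * form p ε h h))⁻¹) 0 := by
      refine DifferentiableAt.inv (DifferentiableAt.sqrt ?_ (by simp)) (by simp)
      fun_prop
    have h2 := h1.hasDerivAt.mul (hasDerivAt_id (0 : ℝ))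
    simpa using h2.smul_const (toMod z' k)
  have := (hder.congr_of_eventuallyEq hline2).unique hline
  rw [hd, ← this]

/-- The horizontal subspace at a representative of `x` is identified with the tangent space at `x`
by the differential of the projection. -/
lemma horLift_apply (x : SpaceForm n p ε c) (u : Mod n) :
    (horLift x u : Amb n) = ofMod (rep x) u := by
  have h : (dproj (rep x)).comp (horizontal p ε (rep x).1).subtypeL =
      (iso (rep x) : _ →L[ℝ] _) := by
    ext1 k
    have := dproj_horizontal (rep x) (rep x) (by rw [proj_rep]) 0
      (by rw [phase_zero, act_real, one_smul]) k.1 k.2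
    rw [phase_zero, act_real, one_smul] at this
    simp [this, toMod, horProj_horizontal]
  rw [horLift, h, ContinuousLinearMap.inverse_equiv]
  rfl

/-- The projection is a pseudo-Riemannian submersion: its differential is isometric on the
horizontal subspace at every point of the hyperquadric. -/
lemma metric_dproj (z : Quadric n p ε c) (h k : Amb n) (hh : h ∈ horizontal p ε z.1)
    (hk : k ∈ horizontal p ε z.1) :
    metric n p ε c (proj z) (dproj z h) (dproj z k) = form p ε h k := by
  obtain ⟨θ, hθ⟩ := (proj_eq_iff z (rep (proj z))).1 (proj_rep _).symm
  have key (m : Amb n) (hm : m ∈ horizontal p ε z.1) :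
      (horLift (proj z) (dproj z m) : Amb n) = act ε (phase ε θ) m := by
    rw [horLift_apply, dproj_horizontal z _ rfl θ hθ m hm, ofMod_toMod, sub_eq_self]
    have e1 : form p ε (act ε (phase ε θ) m) (rep (proj z)).1 = 0 := by
      rw [hθ, form_act_act, hm.1, mul_zero]
    have e2 : form p ε (act ε (phase ε θ) m) (J ε (rep (proj z)).1) = 0 := by
      have : J ε (rep (proj z)).1 = act ε (phase ε θ) (J ε z.1) := by
        rw [hθ, J, J, act_act, act_act]; congr 1; simp [amul]
      rw [this, form_act_act, hm.2, mul_zero]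
    rw [coef_horizontal _ _ ⟨e1, e2⟩, act_eq]; simp
  change form p ε (horLift (proj z) (dproj z h) : Amb n) (horLift (proj z) (dproj z k) : Amb n) = _
  rw [key h hh, key k hk, form_act_act, nsq_phase, one_mul]

end metric

end SpaceFormModel

end

/-!
The argument is local and uses only the Codazzi equation. Let `N` be a unit normal field of a
hypersurface with `∇_u N = -Au`. Commuting covariant derivatives (`curvature_along`) expresses
`R(u,v)N` through `A` (`curvature_of_shapeOperator`); its tangential part is
`(∇̄_v A)u - (∇̄_u A)v` by the Gauss formula (`christoffelFirst_induced`). Hence `R(u,v)N` is a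
combination of `u` and `v` if `A = λ Id`, and it is normal if `∇̄A = 0`.

In a space form, for `u`, `v` orthogonal to `N` and to the tangent vector `JN`, the curvature
equation gives `R(u,v)N = 2c⟨u,Jv⟩ JN` (`modelCurvature_normal`). As the dimension `2n` exceeds `2`,
the orthogonal complement of `N` and `JN` is a non-zero `J`-invariant non-degenerate subspace, so
`⟨u,Jv⟩ ≠ 0` for some `u`, `v` in it (`IsCompatible.exists_pair`). The pairing of `R(u,v)N` with
`JN`, which is not null, is then non-zero, whereas it vanishes in both cases above.

All this takes place in a single pair of charts and uses the structure of the ambient manifold at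
one point only: a metric of class `C²` whose curvature at that point is the one of a space form, for
some compatible `J` at that point (`HasModelCurvatureAt`). For the quotients of hyperquadrics it is
therefore enough to look at the origin of the chart centred at a given point. There the metric is
`⟨u,v⟩ + c⟨y,u⟩⟨y,v⟩ / (1 - c⟨y,y⟩) - εc⟨Jy,u⟩⟨Jy,v⟩` (`metric_inChart`): the second term comes from
the slice `√(1 - c⟨y,y⟩) z₀ + y` of the hyperquadric, and the third one removes the component along
the fibre. Its Christoffel symbols vanish at `0`, and their differential gives the curvature
(`hasModelCurvatureAt_modelMetric`), with constant `εc` in place of `c`.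
-/

noncomputable section

/-! ### Connections along a map, in coordinates -/

namespace PseudoRiem

section Coordinates

-- needed for the norms on iterated spaces of continuous linear maps
set_option maxSynthPendingDepth 3

variable {E : Type*} [NormedAddCommGroup E] [NormedSpace ℝ E]
  {F : Type*} [NormedAddCommGroup F] [NormedSpace ℝ F]
  {G : E → E →L[ℝ] E →L[ℝ] ℝ}

lemma christoffelFirst_apply (G : E → E →L[ℝ] E →L[ℝ] ℝ) (y u v w : E) :
    christoffelFirst G y u v w =
      1 / 2 * (fderiv ℝ G y u v w + fderiv ℝ G y v u w - fderiv ℝ G y w u v) := by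
  simp [christoffelFirst]

/-- Exchange of the arguments of a bilinear map, as a continuous linear map. -/
def flipCLM (V W X : Type*) [NormedAddCommGroup V] [NormedSpace ℝ V] [NormedAddCommGroup W]
    [NormedSpace ℝ W] [NormedAddCommGroup X] [NormedSpace ℝ X] :
    (V →L[ℝ] W →L[ℝ] X) →L[ℝ] (W →L[ℝ] V →L[ℝ] X) :=
  (ContinuousLinearMap.flipₗᵢ ℝ V W X).toContinuousLinearEquiv

/-- The Christoffel symbols as a continuous bilinear map. -/
def christoffelL (G : E → E →L[ℝ] E →L[ℝ] ℝ) (y : E) : E →L[ℝ] E →L[ℝ] E :=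
  (ContinuousLinearMap.compL ℝ E (E →L[ℝ] ℝ) E (G y).inverse).comp
    ((1 / 2 : ℝ) • (fderiv ℝ G y + (fderiv ℝ G y).flip -
      (flipCLM E E ℝ).comp (fderiv ℝ G y).flip))

lemma christoffelL_apply (G : E → E →L[ℝ] E →L[ℝ] ℝ) (y u v : E) :
    christoffelL G y u v = christoffel G y u v := by
  simp only [christoffelL, christoffel, christoffelFirst, ContinuousLinearMap.comp_apply,
    ContinuousLinearMap.compL_apply]
  congr 1

lemma differentiableAt_christoffelL [CompleteSpace E] {x : E} (hG : ContDiffAt ℝ 2 G x)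
    (hi : (G x).IsInvertible) : DifferentiableAt ℝ (christoffelL G) x := by
  have h1 : DifferentiableAt ℝ (fderiv ℝ G) x :=
    (hG.fderiv_right (m := 1) (by norm_num)).differentiableAt one_ne_zero
  have h2 : DifferentiableAt ℝ (fun y => (G y).inverse) x :=
    (hi.contDiffAt_map_inverse (n := 1)).differentiableAt one_ne_zero |>.comp x
      (hG.differentiableAt two_ne_zero)
  have h3 : DifferentiableAt ℝ (fun y => (fderiv ℝ G y).flip) x :=
    (flipCLM E E (E →L[ℝ] ℝ)).differentiableAt.comp x h1
  unfold christoffelL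
  exact ((ContinuousLinearMap.differentiableAt _).comp x h2).clm_comp
    (((h1.fun_add h3).fun_sub ((differentiableAt_const _).clm_comp h3)).fun_const_smul _)

lemma metric_christoffel {y : E} (hi : (G y).IsInvertible) (u v w : E) :
    G y (christoffel G y u v) w = christoffelFirst G y u v w := by
  rw [christoffel, hi.self_apply_inverse]

lemma fderiv_metric_symm {x : E} (hG : DifferentiableAt ℝ G x)
    (hs : ∀ᶠ y in 𝓝 x, ∀ u v, G y u v = G y v u) (w u v : E) :
    fderiv ℝ G x w u v = fderiv ℝ G x w v u := by
  have key (a b : E) : fderiv ℝ (fun y => G y a b) x w = fderiv ℝ G x w a b := by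
    rw [fderiv_clm_apply (hG.clm_apply (differentiableAt_const a)) (differentiableAt_const b),
      fderiv_clm_apply hG (differentiableAt_const a)]
    simp
  rw [← key, ← key]
  have e : (fun y => G y u v) =ᶠ[𝓝 x] fun y => G y v u := hs.mono fun y hy => hy u v
  rw [e.fderiv_eq]

lemma christoffel_symm {x : E} (hG : DifferentiableAt ℝ G x)
    (hs : ∀ᶠ y in 𝓝 x, ∀ u v, G y u v = G y v u) (u v : E) :
    christoffel G x u v = christoffel G x v u := by
  rw [christoffel, christoffel]
  congr 1
  ext w
  rw [christoffelFirst_apply, christoffelFirst_apply, fderiv_metric_symm hG hs w u v]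
  ring

/-- The covariant derivative `∇_u N` of a field `N` along `h`, for the metric `G`. -/
def covAlong (G : E → E →L[ℝ] E →L[ℝ] ℝ) (h N : F → E) (y u : F) : E :=
  fderiv ℝ N y u + christoffel G (h y) (fderiv ℝ h y u) (N y)

/-- The Ricci identity: the curvature is the commutator of the covariant derivatives along `h`. -/
lemma curvature_along [CompleteSpace E] {h N : F → E} {y : F} (hG : ContDiffAt ℝ 2 G (h y))
    (hi : (G (h y)).IsInvertible) (hh : ContDiffAt ℝ 2 h y) (hN : ContDiffAt ℝ 2 N y) (u v : F) :
    curvature G (h y) (fderiv ℝ h y u) (fderiv ℝ h y v) (N y) =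
      (fderiv ℝ (fun z => covAlong G h N z v) y u
        + christoffel G (h y) (fderiv ℝ h y u) (covAlong G h N y v))
      - (fderiv ℝ (fun z => covAlong G h N z u) y v
        + christoffel G (h y) (fderiv ℝ h y v) (covAlong G h N y u)) := by
  have hΓ := differentiableAt_christoffelL hG hi
  have hh1 := hh.differentiableAt two_ne_zero
  have hN1 := hN.differentiableAt two_ne_zero
  have hh2 : DifferentiableAt ℝ (fderiv ℝ h) y :=
    (hh.fderiv_right (m := 1) (by norm_num)).differentiableAt one_ne_zero
  have hN2 : DifferentiableAt ℝ (fderiv ℝ N) y :=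
    (hN.fderiv_right (m := 1) (by norm_num)).differentiableAt one_ne_zero
  have hΓh : DifferentiableAt ℝ (fun z => christoffelL G (h z)) y := hΓ.comp y hh1
  have hd (a b : E) (w : E) : fderiv ℝ (fun z => christoffel G z a b) (h y) w =
      fderiv ℝ (christoffelL G) (h y) w a b := by
    simp only [← christoffelL_apply]
    rw [fderiv_clm_apply (hΓ.clm_apply (differentiableAt_const a)) (differentiableAt_const b),
      fderiv_clm_apply hΓ (differentiableAt_const a)]
    simp
  have key (a b : F) : fderiv ℝ (fun z => covAlong G h N z a) y b =
      fderiv ℝ (fderiv ℝ N) y b a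
      + (fderiv ℝ (christoffelL G) (h y) (fderiv ℝ h y b) (fderiv ℝ h y a) (N y)
        + christoffelL G (h y) (fderiv ℝ (fderiv ℝ h) y b a) (N y)
        + christoffelL G (h y) (fderiv ℝ h y a) (fderiv ℝ N y b)) := by
    simp only [covAlong, ← christoffelL_apply]
    have e1 : DifferentiableAt ℝ (fun z => fderiv ℝ h z a) y :=
      hh2.clm_apply (differentiableAt_const a)
    rw [fderiv_fun_add (hN2.clm_apply (differentiableAt_const a))
      ((hΓh.clm_apply e1).clm_apply hN1), fderiv_clm_apply hN2 (differentiableAt_const a),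
      fderiv_clm_apply (hΓh.clm_apply e1) hN1, fderiv_clm_apply hΓh e1,
      fderiv_clm_apply hh2 (differentiableAt_const a)]
    have e2 : fderiv ℝ (fun z => christoffelL G (h z)) y =
        (fderiv ℝ (christoffelL G) (h y)).comp (fderiv ℝ h y) := fderiv_comp y hΓ hh1
    rw [e2]
    simp
    abel
  have s1 := hh.isSymmSndFDerivAt (by simp) u v
  have s2 := hN.isSymmSndFDerivAt (by simp) u v
  rw [key, key, curvature, hd, hd, s1, s2]
  simp only [covAlong, ← christoffelL_apply, map_add]
  abel

/-- The Codazzi equation before projection to the hypersurface, for a field `N` along `h` such that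
`∇_v N = -A v`. -/
lemma curvature_of_shapeOperator [CompleteSpace E] {h N : F → E} {A : F → F →L[ℝ] F} {y : F}
    (hG : ContDiffAt ℝ 2 G (h y))
    (hi : (G (h y)).IsInvertible) (hh : ContDiffAt ℝ 2 h y) (hN : ContDiffAt ℝ 2 N y)
    (hA : DifferentiableAt ℝ A y)
    (hNA : ∀ᶠ z in 𝓝 y, ∀ u, covAlong G h N z u = -fderiv ℝ h z (A z u)) (u v : F) :
    curvature G (h y) (fderiv ℝ h y u) (fderiv ℝ h y v) (N y) =
      (fderiv ℝ (fderiv ℝ h) y v (A y u)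
        + christoffel G (h y) (fderiv ℝ h y v) (fderiv ℝ h y (A y u)))
      - (fderiv ℝ (fderiv ℝ h) y u (A y v)
        + christoffel G (h y) (fderiv ℝ h y u) (fderiv ℝ h y (A y v)))
      + fderiv ℝ h y (fderiv ℝ A y v u - fderiv ℝ A y u v) := by
  have hh2 : DifferentiableAt ℝ (fderiv ℝ h) y :=
    (hh.fderiv_right (m := 1) (by norm_num)).differentiableAt one_ne_zero
  have key (a b : F) : fderiv ℝ (fun z => covAlong G h N z a) y b =
      -(fderiv ℝ (fderiv ℝ h) y b (A y a) + fderiv ℝ h y (fderiv ℝ A y b a)) := by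
    have e : (fun z => covAlong G h N z a) =ᶠ[𝓝 y] fun z => -fderiv ℝ h z (A z a) :=
      hNA.mono fun z hz => hz a
    rw [e.fderiv_eq, fderiv_fun_neg, fderiv_clm_apply hh2 (hA.clm_apply (differentiableAt_const a)),
      fderiv_clm_apply hA (differentiableAt_const a)]
    simp
    abel
  rw [curvature_along hG hi hh hN, key, key, hNA.self_of_nhds, hNA.self_of_nhds]
  simp only [← christoffelL_apply, map_neg, map_sub]
  abel

/-- The Gauss formula: the Levi-Civita connection of the induced metric is the tangential part of
the ambient connection. -/
lemma christoffelFirst_induced {h : F → E} {H : F → F →L[ℝ] F →L[ℝ] ℝ} {y : F}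
    (hG : DifferentiableAt ℝ G (h y)) (hi : (G (h y)).IsInvertible)
    (hs : ∀ᶠ z in 𝓝 (h y), ∀ u v, G z u v = G z v u) (hh : ContDiffAt ℝ 2 h y)
    (hH : ∀ᶠ z in 𝓝 y, H z = (G (h z)).bilinearComp (fderiv ℝ h z) (fderiv ℝ h z)) (u v w : F) :
    christoffelFirst H y u v w =
      G (h y) (fderiv ℝ (fderiv ℝ h) y u v
        + christoffel G (h y) (fderiv ℝ h y u) (fderiv ℝ h y v)) (fderiv ℝ h y w) := by
  have hh1 := hh.differentiableAt two_ne_zero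
  have hh2 : DifferentiableAt ℝ (fderiv ℝ h) y :=
    (hh.fderiv_right (m := 1) (by norm_num)).differentiableAt one_ne_zero
  have hGh : DifferentiableAt ℝ (fun z => G (h z)) y := hG.comp y hh1
  have hHd : DifferentiableAt ℝ H y := by
    refine DifferentiableAt.congr_of_eventuallyEq ?_ hH
    have e (z : F) : (G (h z)).bilinearComp (fderiv ℝ h z) (fderiv ℝ h z) =
        flipCLM F F ℝ ((flipCLM F E ℝ ((G (h z)).comp (fderiv ℝ h z))).comp (fderiv ℝ h z)) := by
      ext; rfl
    simp only [e]
    exact (ContinuousLinearMap.differentiableAt _).comp y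
      (((ContinuousLinearMap.differentiableAt _).comp y (hGh.clm_comp hh2)).clm_comp hh2)
  have key (a b d : F) : fderiv ℝ H y a b d =
      fderiv ℝ G (h y) (fderiv ℝ h y a) (fderiv ℝ h y b) (fderiv ℝ h y d)
      + G (h y) (fderiv ℝ (fderiv ℝ h) y a b) (fderiv ℝ h y d)
      + G (h y) (fderiv ℝ h y b) (fderiv ℝ (fderiv ℝ h) y a d) := by
    have e1 : fderiv ℝ (fun z => H z b d) y a = fderiv ℝ H y a b d := by
      rw [fderiv_clm_apply (hHd.clm_apply (differentiableAt_const b)) (differentiableAt_const d),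
        fderiv_clm_apply hHd (differentiableAt_const b)]
      simp
    have e2 : (fun z => H z b d) =ᶠ[𝓝 y] fun z => G (h z) (fderiv ℝ h z b) (fderiv ℝ h z d) :=
      hH.mono fun z hz => by simp only [hz]; rfl
    have c1 (b : F) : DifferentiableAt ℝ (fun z => fderiv ℝ h z b) y :=
      hh2.clm_apply (differentiableAt_const b)
    have c2 : fderiv ℝ (fun z => G (h z)) y = (fderiv ℝ G (h y)).comp (fderiv ℝ h y) :=
      fderiv_comp y hG hh1
    rw [← e1, e2.fderiv_eq, fderiv_clm_apply (hGh.clm_apply (c1 b)) (c1 d),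
      fderiv_clm_apply hGh (c1 b), fderiv_clm_apply hh2 (differentiableAt_const b),
      fderiv_clm_apply hh2 (differentiableAt_const d), c2]
    simp
    ring
  have s (a b : F) := hh.isSymmSndFDerivAt (by simp) a b
  have hs0 := hs.self_of_nhds
  rw [map_add, add_apply, metric_christoffel hi, christoffelFirst_apply,
    christoffelFirst_apply, key, key, key, s v u, s w u, s w v,
    hs0 (fderiv ℝ h y v) (fderiv ℝ (fderiv ℝ h) y u w),
    hs0 (fderiv ℝ h y u) (fderiv ℝ (fderiv ℝ h) y v w)]
  ring

/-- A shape operator is differentiable: it is determined by `∇N`, because `h` is an immersion. -/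
lemma differentiableAt_shapeOperator [CompleteSpace E] [FiniteDimensional ℝ F]
    [FiniteDimensional ℝ E]
    {h N : F → E} {A : F → F →L[ℝ] F} {y : F} (hG : ContDiffAt ℝ 2 G (h y))
    (hi : (G (h y)).IsInvertible) (hh : ContDiffAt ℝ 2 h y) (hN : ContDiffAt ℝ 2 N y)
    (hinj : Function.Injective (fderiv ℝ h y))
    (hNA : ∀ᶠ z in 𝓝 y, ∀ u, covAlong G h N z u = -fderiv ℝ h z (A z u)) :
    DifferentiableAt ℝ A y := by
  have hh2 : DifferentiableAt ℝ (fderiv ℝ h) y :=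
    (hh.fderiv_right (m := 1) (by norm_num)).differentiableAt one_ne_zero
  have hN2 : DifferentiableAt ℝ (fderiv ℝ N) y :=
    (hN.fderiv_right (m := 1) (by norm_num)).differentiableAt one_ne_zero
  obtain ⟨L₀, hL₀⟩ := (fderiv ℝ h y).toLinearMap.exists_leftInverse_of_injective
    (LinearMap.ker_eq_bot.2 hinj)
  let L : E →L[ℝ] F := LinearMap.toContinuousLinearMap L₀
  have hL : L.comp (fderiv ℝ h y) = .id ℝ F := by
    ext u; exact congrArg (fun T => T u) hL₀
  have hLd : DifferentiableAt ℝ (fun z => L.comp (fderiv ℝ h z)) y :=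
    (differentiableAt_const L).clm_comp hh2
  have hinv0 : (L.comp (fderiv ℝ h y)).IsInvertible := by
    rw [hL]; exact ⟨.refl ℝ F, rfl⟩
  have hinv : ∀ᶠ z in 𝓝 y, (L.comp (fderiv ℝ h z)).IsInvertible := by
    have h1 : Set.range ((↑) : (F ≃L[ℝ] F) → F →L[ℝ] F) ∈ 𝓝 (L.comp (fderiv ℝ h y)) := by
      rw [hL]; exact ContinuousLinearEquiv.nhds (.refl ℝ F)
    filter_upwards [hLd.continuousAt.eventually_mem h1] with z hz using hz
  have hΓh : DifferentiableAt ℝ (fun z => christoffelL G (h z)) y :=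
    (differentiableAt_christoffelL hG hi).comp y (hh.differentiableAt two_ne_zero)
  have hC : DifferentiableAt ℝ (fun z => fderiv ℝ N z +
      (flipCLM E E E (christoffelL G (h z)) (N z)).comp (fderiv ℝ h z)) y :=
    hN2.add ((((ContinuousLinearMap.differentiableAt _).comp y hΓh).clm_apply
      (hN.differentiableAt two_ne_zero)).clm_comp hh2)
  have hinvd : DifferentiableAt ℝ (fun z => (L.comp (fderiv ℝ h z)).inverse) y :=
    DifferentiableAt.comp (g := ContinuousLinearMap.inverse) y
      ((hinv0.contDiffAt_map_inverse (n := 1)).differentiableAt one_ne_zero) hLd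
  refine DifferentiableAt.congr_of_eventuallyEq
    (hinvd.clm_comp ((differentiableAt_const L).clm_comp hC)).neg ?_
  filter_upwards [hinv, hNA] with z hz hz'
  ext u
  have e := hz' u
  rw [covAlong, ← christoffelL_apply] at e
  symm
  change -(L.comp (fderiv ℝ h z)).inverse (L (fderiv ℝ N z u +
    christoffelL G (h z) (fderiv ℝ h z u) (N z))) = A z u
  rw [e, map_neg, map_neg, neg_neg]
  exact hz.inverse_apply_self _

end Coordinates

end PseudoRiem

/-! ### The curvature of a space form in normal directions -/

namespace PseudoRiem

section Algebra

variable {E : Type*} [NormedAddCommGroup E] [NormedSpace ℝ E]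

/-- `J` is a complex (`ε = 1`) or para-complex (`ε = -1`) structure compatible with the scalar
product `B`. -/
structure IsCompatible (ε : ℤˣ) (B : E →L[ℝ] E →L[ℝ] ℝ) (J : E →L[ℝ] E) : Prop where
  symm : ∀ u v, B u v = B v u
  nondegenerate : ∀ u, (∀ v, B u v = 0) → u = 0
  sq : ∀ u, J (J u) = -((ε : ℤ) : ℝ) • u
  compatible : ∀ u v, B (J u) (J v) = ((ε : ℤ) : ℝ) * B u v

variable {ε : ℤˣ} {B : E →L[ℝ] E →L[ℝ] ℝ} {J : E →L[ℝ] E}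

lemma unit_mul_self (ε : ℤˣ) : ((ε : ℤ) : ℝ) * ((ε : ℤ) : ℝ) = 1 := by
  rcases Int.units_eq_one_or ε with rfl | rfl <;> simp

lemma unit_ne_zero (ε : ℤˣ) : ((ε : ℤ) : ℝ) ≠ 0 := fun h => by
  simpa [h] using unit_mul_self ε

lemma IsCompatible.skew (h : IsCompatible ε B J) (u v : E) : B (J u) v = -B u (J v) := by
  have h1 := h.compatible (J u) v
  rw [h.sq] at h1
  simp only [map_smul, smul_apply, smul_eq_mul] at h1
  exact mul_left_cancel₀ (unit_ne_zero ε) (by linear_combination -h1)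

lemma IsCompatible.apply_J_self (h : IsCompatible ε B J) (u : E) : B u (J u) = 0 := by
  have h1 := h.skew u u
  rw [h.symm] at h1
  linarith

lemma isInvertible_of_nondegenerate [FiniteDimensional ℝ E]
    (h : ∀ u, (∀ v, B u v = 0) → u = 0) : B.IsInvertible := by
  have hinj : Function.Injective B := by
    refine (injective_iff_map_eq_zero B).2 fun u hu => h u fun v => by simp [hu]
  have hd : Module.finrank ℝ E = Module.finrank ℝ (E →L[ℝ] ℝ) := by
    rw [← (LinearMap.toContinuousLinearMap (𝕜 := ℝ) (E := E) (F' := ℝ)).finrank_eq]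
    exact (Subspace.dual_finrank_eq (K := ℝ) (V := E)).symm
  exact ⟨(LinearEquiv.ofInjectiveOfFinrankEq B.toLinearMap hinj hd).toContinuousLinearEquiv,
    by ext; rfl⟩

lemma IsCompatible.isInvertible [FiniteDimensional ℝ E] (h : IsCompatible ε B J) :
    B.IsInvertible :=
  isInvertible_of_nondegenerate h.nondegenerate

/-- In dimension greater than `2`, the orthogonal complement of `N` and `JN` is a non-zero
`J`-invariant non-degenerate subspace, so that the form `⟨·, J·⟩` does not vanish on it. -/
lemma IsCompatible.exists_pair [FiniteDimensional ℝ E] (h : IsCompatible ε B J)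
    (hE : 2 < Module.finrank ℝ E) {N : E} (hN : B N N ≠ 0) :
    ∃ X Y, B N X = 0 ∧ B (J N) X = 0 ∧ B N Y = 0 ∧ B (J N) Y = 0 ∧ B X (J Y) ≠ 0 := by
  have hJN : B (J N) (J N) ≠ 0 := by
    rw [h.compatible]; exact mul_ne_zero (unit_ne_zero ε) hN
  have h0 := h.apply_J_self N
  have h0' : B (J N) N = 0 := by rw [h.symm]; exact h0
  -- a non-zero vector orthogonal to `N` and `JN`, which exists by counting dimensions
  obtain ⟨X, hX, hX0⟩ : ∃ X, (B N X = 0 ∧ B (J N) X = 0) ∧ X ≠ 0 := by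
    obtain ⟨X, hX, hX0⟩ := Submodule.exists_mem_ne_zero_of_ne_bot
      (LinearMap.ker_ne_bot_of_finrank_lt (f := (B N).toLinearMap.prod (B (J N)).toLinearMap)
        (by simpa using hE))
    exact ⟨X, by simpa using hX, hX0⟩
  obtain ⟨Z, hZ⟩ : ∃ Z, B X Z ≠ 0 := by
    by_contra! hc
    exact hX0 (h.nondegenerate X hc)
  let Z' := Z - (B N Z / B N N) • N - (B (J N) Z / B (J N) (J N)) • J N
  have hXN : B X N = 0 := by rw [h.symm]; exact hX.1
  have hXJN : B X (J N) = 0 := by rw [h.symm]; exact hX.2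
  have k1 : B N Z' = 0 := by
    simp only [Z', map_sub, map_smul, smul_eq_mul, h0]; field_simp; simp
  have k2 : B (J N) Z' = 0 := by
    simp only [Z', map_sub, map_smul, smul_eq_mul, h0']; field_simp; simp
  refine ⟨X, J Z', hX.1, hX.2, ?_, ?_, ?_⟩
  · have := h.skew N Z'
    linarith
  · rw [h.compatible, k1, mul_zero]
  · rw [h.sq]
    simp only [Z', map_sub, map_smul, smul_eq_mul, hXN, hXJN, mul_zero, sub_zero]
    exact mul_ne_zero (neg_ne_zero.2 (unit_ne_zero ε)) hZ

/-- If `X` and `Y` are orthogonal to `N` and `JN`, then `R(X,Y)N = 2c⟨X,JY⟩ JN`. -/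
lemma modelCurvature_normal (h : IsCompatible ε B J) (c : ℝ) {N X Y : E}
    (hX : B N X = 0) (hJX : B (J N) X = 0) (hY : B N Y = 0) (hJY : B (J N) Y = 0) :
    modelCurvature ε c B J X Y N = (c * (2 * B X (J Y))) • J N := by
  have e1 : B X N = 0 := by rw [h.symm]; exact hX
  have e2 : B Y N = 0 := by rw [h.symm]; exact hY
  have e3 : B (J X) N = 0 := by rw [h.symm, ← neg_eq_zero, ← h.skew]; exact hJX
  have e4 : B (J Y) N = 0 := by rw [h.symm, ← neg_eq_zero, ← h.skew]; exact hJY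
  simp [modelCurvature, e1, e2, e3, e4, smul_smul]

end Algebra

/-! ### Hypersurfaces in coordinates -/

section Core

-- needed for the norms on iterated spaces of continuous linear maps
set_option maxSynthPendingDepth 3

variable {E : Type*} [NormedAddCommGroup E] [NormedSpace ℝ E] [FiniteDimensional ℝ E]
  {F : Type*} [NormedAddCommGroup F] [NormedSpace ℝ F]
  {G : E → E →L[ℝ] E →L[ℝ] ℝ} {J : E →L[ℝ] E} {ε : ℤˣ} {c : ℝ}

/-- The coordinate expression `G` of a metric has, at the point of coordinates `x`, the curvature of
a space form with respect to the structure `J`. -/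
structure HasModelCurvatureAt (ε : ℤˣ) (c : ℝ) (G : E → E →L[ℝ] E →L[ℝ] ℝ) (J : E →L[ℝ] E)
    (x : E) : Prop where
  smooth : ContDiffAt ℝ 2 G x
  symm : ∀ᶠ y in 𝓝 x, ∀ u v, G y u v = G y v u
  compatible : IsCompatible ε (G x) J
  curvature_eq : ∀ u v w, curvature G x u v w = modelCurvature ε c (G x) J u v w

/-- The data of a hypersurface `h` with normal field `N` and shape operator `A` near the point of
coordinates `y`: the equation `∇N = -A` holds near `y`, and `N` is a non-null normal vector
at `y`. -/
structure IsLocalHypersurface (G : E → E →L[ℝ] E →L[ℝ] ℝ) (h N : F → E) (A : F → F →L[ℝ] F)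
    (y : F) : Prop where
  codim_one : Module.finrank ℝ E = Module.finrank ℝ F + 1
  smooth : ContDiffAt ℝ 2 h y
  smooth_normal : ContDiffAt ℝ 2 N y
  immersion : Function.Injective (fderiv ℝ h y)
  normal : ∀ u, G (h y) (N y) (fderiv ℝ h y u) = 0
  nonnull : G (h y) (N y) (N y) ≠ 0
  shape : ∀ᶠ z in 𝓝 y, ∀ u, covAlong G h N z u = -fderiv ℝ h z (A z u)

/-- The tangent space of a hypersurface is the orthogonal complement of the normal vector. -/
lemma IsLocalHypersurface.exists_tangent {h N : F → E} {A : F → F →L[ℝ] F} {y : F}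
    (H : IsLocalHypersurface G h N A y) {X : E} (hX : G (h y) (N y) X = 0) :
    ∃ u, fderiv ℝ h y u = X := by
  have hle : LinearMap.range (fderiv ℝ h y).toLinearMap ≤
      LinearMap.ker (G (h y) (N y)).toLinearMap := by
    rintro _ ⟨u, rfl⟩
    exact H.normal u
  have hs : LinearMap.range (G (h y) (N y)).toLinearMap = ⊤ :=
    LinearMap.range_eq_top.2 (LinearMap.surjective fun h0 => H.nonnull (by
      simpa using congrArg (fun T => T (N y)) h0))
  have h1 := (G (h y) (N y)).toLinearMap.finrank_range_add_finrank_ker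
  rw [hs, finrank_top, Module.finrank_self] at h1
  have h2 := LinearMap.finrank_range_of_inj (f := (fderiv ℝ h y).toLinearMap) H.immersion
  have h3 := H.codim_one
  have he := Submodule.eq_of_le_of_finrank_eq hle (by omega)
  have hm : X ∈ LinearMap.ker (G (h y) (N y)).toLinearMap := hX
  rw [← he] at hm
  exact hm

/-- On a hypersurface of a space form of curvature `c ≠ 0`, there are tangent vectors `u`, `v`, `w`
such that `w` corresponds to `JN`, `u` and `v` are orthogonal to `w`, and `⟨R(u,v)N, w⟩ ≠ 0`. -/
lemma IsLocalHypersurface.exists_curvature_ne_zero {h N : F → E} {A : F → F →L[ℝ] F} {y : F}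
    (H : IsLocalHypersurface G h N A y) (hM : HasModelCurvatureAt ε c G J (h y)) (hc : c ≠ 0)
    (hE : 2 < Module.finrank ℝ E) : ∃ u v w : F,
      G (h y) (fderiv ℝ h y u) (fderiv ℝ h y w) = 0 ∧
      G (h y) (fderiv ℝ h y v) (fderiv ℝ h y w) = 0 ∧
      G (h y) (curvature G (h y) (fderiv ℝ h y u) (fderiv ℝ h y v) (N y)) (fderiv ℝ h y w) ≠ 0 := by
  have hB := hM.compatible
  obtain ⟨X, Y, hX, hJX, hY, hJY, hXY⟩ := hB.exists_pair hE H.nonnull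
  obtain ⟨u, hu⟩ := H.exists_tangent hX
  obtain ⟨v, hv⟩ := H.exists_tangent hY
  obtain ⟨w, hw⟩ := H.exists_tangent (hB.apply_J_self (N y))
  refine ⟨u, v, w, ?_, ?_, ?_⟩
  · rw [hu, hw, hB.symm]; exact hJX
  · rw [hv, hw, hB.symm]; exact hJY
  · rw [hu, hv, hw, hM.curvature_eq, modelCurvature_normal hB c hX hJX hY hJY]
    simp only [map_smul, smul_apply, smul_eq_mul, hB.compatible]
    have := unit_ne_zero ε
    have := H.nonnull
    positivity

/-- If `A = λ Id`, then `R(u,v)N` is a combination of `u` and `v`, hence orthogonal to `JN` for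
suitable `u` and `v`, although `⟨R(u,v)N, JN⟩ ≠ 0`. -/
lemma IsLocalHypersurface.not_umbilic {h N : F → E} {A : F → F →L[ℝ] F} {y : F}
    (H : IsLocalHypersurface G h N A y) (hM : HasModelCurvatureAt ε c G J (h y)) (hc : c ≠ 0)
    (hE : 2 < Module.finrank ℝ E) {l : F → ℝ} (hl : DifferentiableAt ℝ l y)
    (hA : ∀ᶠ z in 𝓝 y, ∀ u, A z u = l z • u) : False := by
  have := FiniteDimensional.complete ℝ E
  obtain ⟨u, v, w, hu, hv, hR⟩ := H.exists_curvature_ne_zero hM hc hE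
  have hA' : A =ᶠ[𝓝 y] fun z => l z • ContinuousLinearMap.id ℝ F :=
    hA.mono fun z hz => by ext u; simpa using hz u
  have hAd : DifferentiableAt ℝ A y :=
    (hl.smul (differentiableAt_const _)).congr_of_eventuallyEq hA'
  have hfA (a b : F) : fderiv ℝ A y a b = fderiv ℝ l y a • b := by
    rw [hA'.fderiv_eq, fderiv_fun_smul hl (differentiableAt_const _)]
    simp
  have s := H.smooth.isSymmSndFDerivAt (by simp) u v
  have s' := christoffel_symm (hM.smooth.differentiableAt two_ne_zero) hM.symm
    (fderiv ℝ h y u) (fderiv ℝ h y v)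
  apply hR
  rw [curvature_of_shapeOperator hM.smooth hM.compatible.isInvertible H.smooth H.smooth_normal hAd
    H.shape, hA.self_of_nhds, hA.self_of_nhds, hfA, hfA]
  simp only [← christoffelL_apply, map_smul, map_sub] at s' ⊢
  simp only [s, s', sub_self, zero_add, map_sub, map_smul, _root_.sub_apply, smul_apply, hu, hv,
    smul_zero]

/-- If `A` is parallel for the induced connection, then `R(u,v)N` is normal, hence orthogonal to
`JN`, although `⟨R(u,v)N, JN⟩ ≠ 0` for suitable `u` and `v`. -/
lemma IsLocalHypersurface.not_parallel [FiniteDimensional ℝ F] {h N : F → E} {A : F → F →L[ℝ] F}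
    {y : F}
    (H : IsLocalHypersurface G h N A y) (hM : HasModelCurvatureAt ε c G J (h y)) (hc : c ≠ 0)
    (hE : 2 < Module.finrank ℝ E) {I : F → F →L[ℝ] F →L[ℝ] ℝ}
    (hI : ∀ᶠ z in 𝓝 y, I z = (G (h z)).bilinearComp (fderiv ℝ h z) (fderiv ℝ h z))
    (hIi : (I y).IsInvertible)
    (hA : ∀ u v, covDerivEnd I A y u v = 0) : False := by
  have := FiniteDimensional.complete ℝ E
  obtain ⟨u, v, w, hu, hv, hR⟩ := H.exists_curvature_ne_zero hM hc hE
  have hi := hM.compatible.isInvertible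
  have hAd := differentiableAt_shapeOperator hM.smooth hi H.smooth H.smooth_normal H.immersion
    H.shape
  have hI0 (a b : F) : I y a b = G (h y) (fderiv ℝ h y a) (fderiv ℝ h y b) := by
    rw [hI.self_of_nhds]; rfl
  have key (a b : F) : G (h y) (fderiv ℝ (fderiv ℝ h) y a b
      + christoffel G (h y) (fderiv ℝ h y a) (fderiv ℝ h y b)) (fderiv ℝ h y w) =
      G (h y) (fderiv ℝ h y (christoffel I y a b)) (fderiv ℝ h y w) := by
    rw [← hI0, metric_christoffel hIi, christoffelFirst_induced
      (hM.smooth.differentiableAt two_ne_zero) hi hM.symm H.smooth hI]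
  have hsymm : christoffel I y u v = christoffel I y v u := by
    rw [christoffel, christoffel]
    congr 1
    ext d
    have s := H.smooth.isSymmSndFDerivAt (by simp) u v
    have s' := christoffel_symm (hM.smooth.differentiableAt two_ne_zero) hM.symm
      (fderiv ℝ h y u) (fderiv ℝ h y v)
    rw [christoffelFirst_induced (hM.smooth.differentiableAt two_ne_zero) hi hM.symm H.smooth hI,
      christoffelFirst_induced (hM.smooth.differentiableAt two_ne_zero) hi hM.symm H.smooth hI,
      s, s']
  have h1 := hA u v
  have h2 := hA v u
  rw [covDerivEnd, hsymm] at h1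
  rw [covDerivEnd] at h2
  apply hR
  have e : christoffel I y v (A y u) - christoffel I y u (A y v)
      + (fderiv ℝ A y v u - fderiv ℝ A y u v) = 0 := by
    have h3 := congrArg₂ (· - ·) h2 h1
    rw [sub_zero] at h3
    rw [← h3]
    abel
  rw [curvature_of_shapeOperator hM.smooth hi H.smooth H.smooth_normal hAd H.shape, map_add,
    map_sub, add_apply, _root_.sub_apply, key, key, ← _root_.sub_apply, ← map_sub, ← add_apply,
    ← map_add, ← map_sub, ← map_add, e]
  simp

end Core

end PseudoRiem

/-! ### From manifolds to coordinates -/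

namespace PseudoRiem

section Charts

variable {E : Type*} [NormedAddCommGroup E] [NormedSpace ℝ E]
  {M : Type*} [TopologicalSpace M] [ChartedSpace E M]

lemma mdifferentiable_of_mem_smoothCharts {ψ : OpenPartialHomeomorph M E}
    (hψ : ψ ∈ smoothCharts E M) : ψ.MDifferentiable 𝓘(ℝ, E) 𝓘(ℝ, E) :=
  ⟨fun _ hx => ((contMDiffAt_of_mem_maximalAtlas hψ hx).mdifferentiableAt
      (by simp)).mdifferentiableWithinAt,
    fun _ hx => ((contMDiffAt_symm_of_mem_maximalAtlas hψ hx).mdifferentiableAt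
      (by simp)).mdifferentiableWithinAt⟩

lemma mfderiv_chart_mfderiv_symm [IsManifold 𝓘(ℝ, E) ∞ M] {ψ : OpenPartialHomeomorph M E}
    (hψ : ψ ∈ smoothCharts E M)
    {y : E} (hy : y ∈ ψ.target) (u : E) :
    (mfderiv 𝓘(ℝ, E) 𝓘(ℝ, E) ψ (ψ.symm y) (mfderiv 𝓘(ℝ, E) 𝓘(ℝ, E) ψ.symm y u) : E) = u :=
  congrArg (fun T => T u) ((mdifferentiable_of_mem_smoothCharts hψ).comp_symm_deriv hy)

lemma mfderiv_symm_mfderiv_chart [IsManifold 𝓘(ℝ, E) ∞ M] {ψ : OpenPartialHomeomorph M E}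
    (hψ : ψ ∈ smoothCharts E M)
    {y : E} (hy : y ∈ ψ.target) (u : E) :
    (mfderiv 𝓘(ℝ, E) 𝓘(ℝ, E) ψ.symm y (mfderiv 𝓘(ℝ, E) 𝓘(ℝ, E) ψ (ψ.symm y) u) : E) = u :=
  (mdifferentiable_of_mem_smoothCharts hψ).mfderiv_injective (ψ.map_target hy)
    (mfderiv_chart_mfderiv_symm hψ hy _)

/-- The coordinate expression of a metric, in terms of the differential of the chart. -/
lemma BilinField.inChart_mfderiv [IsManifold 𝓘(ℝ, E) ∞ M] (g : BilinField E M)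
    {ψ : OpenPartialHomeomorph M E}
    (hψ : ψ ∈ smoothCharts E M) {x : M} (hx : x ∈ ψ.source) (u v : E) :
    g.inChart ψ (ψ x) (mfderiv 𝓘(ℝ, E) 𝓘(ℝ, E) ψ x u) (mfderiv 𝓘(ℝ, E) 𝓘(ℝ, E) ψ x v) =
      g x u v := by
  have h (w : E) : (mfderiv 𝓘(ℝ, E) 𝓘(ℝ, E) ψ.symm (ψ x)
      (mfderiv 𝓘(ℝ, E) 𝓘(ℝ, E) ψ x w) : E) = w :=
    congrArg (fun T => T w) ((mdifferentiable_of_mem_smoothCharts hψ).symm_comp_deriv hx)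
  have key (x' : M) (hx' : x' = x) (a b : E) : (g x' a b : ℝ) = g x a b := by subst hx'; rfl
  refine Eq.trans ?_ (key _ (ψ.left_inv hx) u v)
  change g (ψ.symm (ψ x)) (mfderiv 𝓘(ℝ, E) 𝓘(ℝ, E) ψ.symm (ψ x) _)
    (mfderiv 𝓘(ℝ, E) 𝓘(ℝ, E) ψ.symm (ψ x) _) = _
  exact congrArg₂ (fun a b : E => (g (ψ.symm (ψ x)) a b : ℝ)) (h u) (h v)

lemma BilinField.inChart_apply (g : BilinField E M) (ψ : OpenPartialHomeomorph M E) (y u v : E) :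
    g.inChart ψ y u v = g (ψ.symm y) (mfderiv 𝓘(ℝ, E) 𝓘(ℝ, E) ψ.symm y u)
      (mfderiv 𝓘(ℝ, E) 𝓘(ℝ, E) ψ.symm y v) := rfl

lemma BilinField.inChart_symm (g : BilinField E M) (ψ : OpenPartialHomeomorph M E)
    (hg : ∀ x u v, g x u v = g x v u) (y u v : E) : g.inChart ψ y u v = g.inChart ψ y v u := by
  rw [g.inChart_apply, g.inChart_apply]
  exact hg _ _ _

lemma mfderiv_symm_inChart [IsManifold 𝓘(ℝ, E) ∞ M] (J : EndField E M)
    {ψ : OpenPartialHomeomorph M E}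
    (hψ : ψ ∈ smoothCharts E M) {y : E} (hy : y ∈ ψ.target) (u : E) :
    mfderiv 𝓘(ℝ, E) 𝓘(ℝ, E) ψ.symm y (J.inChart ψ y u) =
      J (ψ.symm y) (mfderiv 𝓘(ℝ, E) 𝓘(ℝ, E) ψ.symm y u) :=
  mfderiv_symm_mfderiv_chart hψ hy _

lemma BilinField.inChart_nondegenerate [IsManifold 𝓘(ℝ, E) ∞ M] {g : BilinField E M}
    {ψ : OpenPartialHomeomorph M E}
    (hψ : ψ ∈ smoothCharts E M) {y : E} (hy : y ∈ ψ.target)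
    (hg : ∀ u, (∀ v, g (ψ.symm y) u v = 0) → u = 0) {u : E} (hu : ∀ v, g.inChart ψ y u v = 0) :
    u = 0 := by
  have hb := (mdifferentiable_of_mem_smoothCharts hψ).symm.mfderiv_bijective hy
  have h1 := hg (mfderiv 𝓘(ℝ, E) 𝓘(ℝ, E) ψ.symm y u) fun v => by
    obtain ⟨w, rfl⟩ := hb.2 v
    exact hu w
  exact hb.1 (h1.trans (map_zero _).symm)

lemma IsSpaceForm.inChart_sq [IsManifold 𝓘(ℝ, E) ∞ M] {ε : ℤˣ} {c : ℝ} {g : BilinField E M}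
    {J : EndField E M}
    (h : IsSpaceForm ε c g J) {ψ : OpenPartialHomeomorph M E} (hψ : ψ ∈ smoothCharts E M)
    {y : E} (hy : y ∈ ψ.target) (u : E) :
    J.inChart ψ y (J.inChart ψ y u) = -((ε : ℤ) : ℝ) • u := by
  have hb := (mdifferentiable_of_mem_smoothCharts hψ).symm.mfderiv_bijective hy
  refine hb.1 ?_
  rw [mfderiv_symm_inChart J hψ hy, mfderiv_symm_inChart J hψ hy, h.J_J]
  exact (map_smul _ _ _).symm

/-- A space form has the model curvature in every chart. -/
lemma IsSpaceForm.hasModelCurvatureAt [IsManifold 𝓘(ℝ, E) ∞ M] {ε : ℤˣ} {c : ℝ}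
    {g : BilinField E M} {J : EndField E M}
    (h : IsSpaceForm ε c g J) {ψ : OpenPartialHomeomorph M E} (hψ : ψ ∈ smoothCharts E M)
    {y : E} (hy : y ∈ ψ.target) :
    HasModelCurvatureAt ε c (g.inChart ψ) (J.inChart ψ y) y where
  smooth := ((h.metric.smooth ψ hψ).contDiffAt (ψ.open_target.mem_nhds hy)).of_le
    ENat.LEInfty.out
  symm := Filter.Eventually.of_forall fun y => g.inChart_symm ψ h.metric.symm y
  curvature_eq := h.curvature_eq ψ hψ y hy
  compatible :=
    { symm := g.inChart_symm ψ h.metric.symm y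
      nondegenerate := fun _ => g.inChart_nondegenerate hψ hy (h.metric.nondegenerate _)
      sq := h.inChart_sq hψ hy
      compatible := fun u v => by
        rw [g.inChart_apply, g.inChart_apply, mfderiv_symm_inChart J hψ hy,
          mfderiv_symm_inChart J hψ hy]
        exact h.compatible _ _ _ }

variable {F : Type*} [NormedAddCommGroup F] [NormedSpace ℝ F]
  {S : Type*} [TopologicalSpace S] [ChartedSpace F S]
  {g : BilinField E M} {f : S → M} {ψ : OpenPartialHomeomorph M E}
  {φ : OpenPartialHomeomorph S F} {U : Set S} {y : F}

lemma contDiffAt_inCharts (hf : ContMDiff 𝓘(ℝ, F) 𝓘(ℝ, E) ∞ f) (hψ : ψ ∈ smoothCharts E M)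
    (hφ : φ ∈ smoothCharts F S) (hy : y ∈ chartDomain f U φ ψ) :
    ContDiffAt ℝ ∞ (ψ ∘ f ∘ φ.symm) y :=
  ((contMDiffAt_of_mem_maximalAtlas hψ hy.2.2).comp y
    ((hf _).comp y (contMDiffAt_symm_of_mem_maximalAtlas hφ hy.1))).contDiffAt

lemma fderiv_inCharts [IsManifold 𝓘(ℝ, E) ∞ M] [IsManifold 𝓘(ℝ, F) ∞ S]
    (hf : ContMDiff 𝓘(ℝ, F) 𝓘(ℝ, E) ∞ f) (hψ : ψ ∈ smoothCharts E M)
    (hφ : φ ∈ smoothCharts F S) (hy : y ∈ chartDomain f U φ ψ) (u : F) :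
    fderiv ℝ (ψ ∘ f ∘ φ.symm) y u =
      mfderiv 𝓘(ℝ, E) 𝓘(ℝ, E) ψ (f (φ.symm y)) (mfderiv 𝓘(ℝ, F) 𝓘(ℝ, E) f (φ.symm y)
        (mfderiv 𝓘(ℝ, F) 𝓘(ℝ, F) φ.symm y u)) := by
  have h1 := (mdifferentiable_of_mem_smoothCharts hψ).mdifferentiableAt hy.2.2
  have h2 := (hf (φ.symm y)).mdifferentiableAt (by simp)
  have h3 := (mdifferentiable_of_mem_smoothCharts hφ).mdifferentiableAt_symm hy.1
  rw [← mfderiv_eq_fderiv, mfderiv_comp y h1 (h2.comp y h3), mfderiv_comp y h2 h3]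
  rfl

lemma chartDomain_mem_nhds (hf : ContMDiff 𝓘(ℝ, F) 𝓘(ℝ, E) ∞ f) (hU : IsOpen U)
    (hy : y ∈ chartDomain f U φ ψ) : chartDomain f U φ ψ ∈ 𝓝 y := by
  have h := φ.symm.isOpen_inter_preimage (hU.inter (ψ.open_source.preimage hf.continuous))
  exact h.mem_nhds hy

lemma induced_inChart [IsManifold 𝓘(ℝ, E) ∞ M] [IsManifold 𝓘(ℝ, F) ∞ S]
    (hf : ContMDiff 𝓘(ℝ, F) 𝓘(ℝ, E) ∞ f) (hψ : ψ ∈ smoothCharts E M)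
    (hφ : φ ∈ smoothCharts F S) (hy : y ∈ chartDomain f U φ ψ) :
    (induced (F := F) g f).inChart φ y =
      (g.inChart ψ ((ψ ∘ f ∘ φ.symm) y)).bilinearComp (fderiv ℝ (ψ ∘ f ∘ φ.symm) y)
        (fderiv ℝ (ψ ∘ f ∘ φ.symm) y) := by
  ext u v
  change _ = g.inChart ψ (ψ (f (φ.symm y))) (fderiv ℝ (ψ ∘ f ∘ φ.symm) y u)
    (fderiv ℝ (ψ ∘ f ∘ φ.symm) y v)
  rw [fderiv_inCharts hf hψ hφ hy, fderiv_inCharts hf hψ hφ hy]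
  exact (g.inChart_mfderiv hψ hy.2.2 _ _).symm

lemma induced_inChart_isInvertible [IsManifold 𝓘(ℝ, F) ∞ S] [FiniteDimensional ℝ F]
    (hf : IsNondegenerateHypersurface F g f)
    (hφ : φ ∈ smoothCharts F S) (hy : y ∈ φ.target) :
    ((induced (F := F) g f).inChart φ y).IsInvertible := 
  isInvertible_of_nondegenerate fun _ =>
    BilinField.inChart_nondegenerate hφ hy (hf.nondegenerate _)

/-- The coordinate expressions of a non-degenerate hypersurface with unit normal field `N` and shape
operator `A`. -/
lemma IsNondegenerateHypersurface.isLocalHypersurface [IsManifold 𝓘(ℝ, E) ∞ M]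
    [IsManifold 𝓘(ℝ, F) ∞ S] (hf : IsNondegenerateHypersurface F g f)
    (hψ : ψ ∈ smoothCharts E M) (hφ : φ ∈ smoothCharts F S) (hU : IsOpen U)
    (hy : y ∈ chartDomain f U φ ψ) {N : FieldAlong E f} {A : EndField F S}
    (hN : IsUnitNormalOn F g N U) (hA : IsShapeOperatorOn g N A U) :
    IsLocalHypersurface (g.inChart ψ) (ψ ∘ f ∘ φ.symm) (N.inChart φ ψ) (A.inChart φ) y where
  codim_one := hf.codim_one
  smooth := (contDiffAt_inCharts hf.smooth hψ hφ hy).of_le ENat.LEInfty.out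
  smooth_normal := ((hN.smooth φ hφ ψ hψ).contDiffAt
    (chartDomain_mem_nhds hf.smooth hU hy)).of_le ENat.LEInfty.out
  immersion u v huv := by
    rw [fderiv_inCharts hf.smooth hψ hφ hy, fderiv_inCharts hf.smooth hψ hφ hy] at huv
    exact (mdifferentiable_of_mem_smoothCharts hφ).symm.mfderiv_injective hy.1 (hf.immersion _
      ((mdifferentiable_of_mem_smoothCharts hψ).mfderiv_injective hy.2.2 huv))
  normal u := by
    rw [fderiv_inCharts hf.smooth hψ hφ hy]
    exact (g.inChart_mfderiv hψ hy.2.2 _ _).trans (hN.normal _ hy.2.1 _)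
  nonnull := by
    have e : g.inChart ψ (ψ (f (φ.symm y))) (N.inChart φ ψ y) (N.inChart φ ψ y) =
        g (f (φ.symm y)) (N (φ.symm y)) (N (φ.symm y)) := g.inChart_mfderiv hψ hy.2.2 _ _
    refine ne_of_eq_of_ne e ?_
    rcases hN.unit _ hy.2.1 with h | h <;> rw [h] <;> norm_num
  shape := by
    filter_upwards [chartDomain_mem_nhds hf.smooth hU hy] with z hz u
    exact hA φ hφ ψ hψ z hz u

end Charts

section Main

variable {E : Type*} [NormedAddCommGroup E] [NormedSpace ℝ E] [FiniteDimensional ℝ E]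
  {M : Type*} [TopologicalSpace M] [ChartedSpace E M] [IsManifold 𝓘(ℝ, E) ∞ M]
  {F : Type*} [NormedAddCommGroup F] [NormedSpace ℝ F] [FiniteDimensional ℝ F]
  {S : Type*} [TopologicalSpace S] [ChartedSpace F S] [IsManifold 𝓘(ℝ, F) ∞ S]
  {g : BilinField E M} {f : S → M} {ε : ℤˣ} {c : ℝ}

/-- A hypersurface is neither umbilic nor with parallel shape operator near a point of a manifold at
which the curvature is that of a space form of curvature `c ≠ 0`. -/
theorem IsNondegenerateHypersurface.not_umbilic_and_not_parallel
    (hf : IsNondegenerateHypersurface F g f) (hc : c ≠ 0) (hE : 2 < Module.finrank ℝ E)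
    {ψ : OpenPartialHomeomorph M E} (hψ : ψ ∈ smoothCharts E M) (p : S) (hp : f p ∈ ψ.source)
    {J : E →L[ℝ] E} (hM : HasModelCurvatureAt ε c (g.inChart ψ) J (ψ (f p))) :
    ¬ IsUmbilic F g f ∧ ¬ HasParallelShapeOperator F g f := by
  let φ := chartAt F p
  have hφ : φ ∈ smoothCharts F S := IsManifold.chart_mem_maximalAtlas p
  have hpφ : φ.symm (φ p) = p := φ.left_inv (mem_chart_source F p)
  have hM' : HasModelCurvatureAt ε c (g.inChart ψ) J ((ψ ∘ f ∘ φ.symm) (φ p)) := by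
    simpa only [Function.comp_apply, hpφ] using hM
  have hd {U : Set S} (hpU : p ∈ U) : φ p ∈ chartDomain f U φ ψ :=
    ⟨mem_chart_target F p, by
      rw [Set.mem_preimage, hpφ]; exact ⟨hpU, hp⟩⟩
  constructor
  · intro h
    obtain ⟨U, hU, hpU, N, A, l, hN, hA, hl, hAl⟩ := h p
    refine (hf.isLocalHypersurface hψ hφ hU (hd hpU) hN hA).not_umbilic hM' hc hE
      (l := l ∘ φ.symm) ?_ ?_
    · have h1 : ContMDiffAt 𝓘(ℝ, F) 𝓘(ℝ, ℝ) ∞ l (φ.symm (φ p)) :=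
        hl.contMDiffAt (hU.mem_nhds (by rwa [hpφ]))
      exact ((h1.comp (φ p) (contMDiffAt_symm_of_mem_maximalAtlas hφ
        (mem_chart_target F p))).contDiffAt).differentiableAt (by simp)
    · filter_upwards [chartDomain_mem_nhds hf.smooth hU (hd hpU)] with z hz u
      have e := mfderiv_chart_mfderiv_symm hφ hz.1 u
      have h1 := hAl _ hz.2.1 (mfderiv 𝓘(ℝ, F) 𝓘(ℝ, F) φ.symm z u)
      change mfderiv 𝓘(ℝ, F) 𝓘(ℝ, F) φ (φ.symm z)
        (A (φ.symm z) (mfderiv 𝓘(ℝ, F) 𝓘(ℝ, F) φ.symm z u)) = l (φ.symm z) • u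
      rw [h1]
      exact (map_smul _ _ _).trans (congrArg (l (φ.symm z) • ·) e)
  · intro h
    obtain ⟨U, hU, hpU, N, A, hN, hA, hAp⟩ := h p
    refine (hf.isLocalHypersurface hψ hφ hU (hd hpU) hN hA).not_parallel hM' hc hE
      (I := (induced (F := F) g f).inChart φ) ?_
      (induced_inChart_isInvertible hf hφ (mem_chart_target F p)) ?_
    · filter_upwards [chartDomain_mem_nhds hf.smooth hU (hd hpU)] with z hz
      exact induced_inChart hf.smooth hψ hφ hz
    · exact hAp φ hφ (φ p) ⟨mem_chart_target F p, by rw [Set.mem_preimage, hpφ]; exact hpU⟩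

end Main

end PseudoRiem

/-! ### The curvature of the model metric -/

namespace PseudoRiem

section ModelMetric

-- needed for the norms on iterated spaces of continuous linear maps
set_option maxSynthPendingDepth 3

variable {E : Type*} [NormedAddCommGroup E] [NormedSpace ℝ E]

lemma curvature_congr {G G' : E → E →L[ℝ] E →L[ℝ] ℝ} {x : E} (h : G =ᶠ[𝓝 x] G') (u v w : E) :
    curvature G x u v w = curvature G' x u v w := by
  have hΓ (a b : E) : (fun z => christoffel G z a b) =ᶠ[𝓝 x] fun z => christoffel G' z a b := by
    filter_upwards [h, h.fderiv (𝕜 := ℝ)] with z h1 h2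
    simp only [christoffel, christoffelFirst, h1, h2]
  have hΓ0 (a b : E) : christoffel G x a b = christoffel G' x a b := (hΓ a b).self_of_nhds
  simp only [curvature, (hΓ _ _).fderiv_eq, hΓ0]

/-- The metric `⟨u,v⟩ + c⟨y,u⟩⟨y,v⟩ / (1 - c⟨y,y⟩) - εc⟨Jy,u⟩⟨Jy,v⟩` at `y`, which is the
coordinate expression of the metric of a space form in an affine horizontal slice of the
hyperquadric. -/
def modelMetric (ε : ℤˣ) (c : ℝ) (B : E →L[ℝ] E →L[ℝ] ℝ) (J : E →L[ℝ] E) (y : E) :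
    E →L[ℝ] E →L[ℝ] ℝ :=
  B + (c / (1 - c * B y y)) • (B y).smulRight (B y)
    - (((ε : ℤ) : ℝ) * c) • (B (J y)).smulRight (B (J y))

variable {ε : ℤˣ} {c : ℝ} {B : E →L[ℝ] E →L[ℝ] ℝ} {J : E →L[ℝ] E}

lemma modelMetric_apply (y u v : E) : modelMetric ε c B J y u v =
    B u v + c / (1 - c * B y y) * (B y u * B y v)
      - ((ε : ℤ) : ℝ) * c * (B (J y) u * B (J y) v) := by
  simp [modelMetric]

lemma modelMetric_zero : modelMetric ε c B J 0 = B := by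
  ext u v; simp [modelMetric_apply]

lemma eventually_ne_zero_modelMetric :
    ∀ᶠ y in 𝓝 (0 : E), 1 - c * B y y ≠ 0 := by
  have h : Continuous fun y : E => 1 - c * B y y := by fun_prop
  exact h.continuousAt.eventually_ne (by simp)

lemma contDiffAt_modelMetric {y : E} (hy : 1 - c * B y y ≠ 0) :
    ContDiffAt ℝ 2 (modelMetric ε c B J) y := by
  have e (L : E → E →L[ℝ] ℝ) (hL : ContDiffAt ℝ 2 L y) :
      ContDiffAt ℝ 2 (fun y => (L y).smulRight (L y)) y :=
    ((ContinuousLinearMap.smulRightL ℝ E (E →L[ℝ] ℝ)).contDiff.contDiffAt.comp y hL).clm_apply hL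
  have h1 : ContDiffAt ℝ 2 (fun y => B y) y := B.contDiff.contDiffAt
  have h2 : ContDiffAt ℝ 2 (fun y => B (J y)) y := (B.comp J).contDiff.contDiffAt
  have h3 : ContDiffAt ℝ 2 (fun y => c / (1 - c * B y y)) y :=
    contDiffAt_const.div (contDiffAt_const.sub (contDiffAt_const.mul (h1.clm_apply contDiffAt_id)))
      hy
  exact (contDiffAt_const.add (h3.smul (e _ h1))).sub ((e _ h2).const_smul _)

lemma fderiv_modelMetric (hB : ∀ u v, B u v = B v u) {y : E} (hy : 1 - c * B y y ≠ 0)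
    (u v w : E) : fderiv ℝ (modelMetric ε c B J) y u v w =
      c / (1 - c * B y y) * (B u v * B y w + B y v * B u w)
      + 2 * c ^ 2 * B y u / (1 - c * B y y) ^ 2 * (B y v * B y w)
      - ((ε : ℤ) : ℝ) * c * (B (J u) v * B (J y) w + B (J y) v * B (J u) w) := by
  have hd := (contDiffAt_modelMetric (ε := ε) (J := J) hy).differentiableAt two_ne_zero
  have e1 : fderiv ℝ (fun z => modelMetric ε c B J z v w) y u =
      fderiv ℝ (modelMetric ε c B J) y u v w := by
    rw [fderiv_clm_apply (hd.clm_apply (differentiableAt_const v)) (differentiableAt_const w),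
      fderiv_clm_apply hd (differentiableAt_const v)]
    simp
  have hl : HasDerivAt (fun t : ℝ => y + t • u) u 0 := by
    simpa using ((hasDerivAt_id (0 : ℝ)).smul_const u).const_add y
  have hline : HasDerivAt (fun t : ℝ => modelMetric ε c B J (y + t • u) v w)
      (fderiv ℝ (fun z => modelMetric ε c B J z v w) y u) 0 := by
    have h2 : HasFDerivAt (fun z => modelMetric ε c B J z v w)
        (fderiv ℝ (fun z => modelMetric ε c B J z v w) y) (y + (0 : ℝ) • u) := by
      simpa using ((hd.clm_apply (differentiableAt_const v)).clm_apply
        (differentiableAt_const w)).hasFDerivAt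
    exact h2.comp_hasDerivAt 0 hl
  have hc (L : E →L[ℝ] ℝ) : HasDerivAt (fun t : ℝ => L (y + t • u)) (L u) 0 :=
    L.hasFDerivAt.comp_hasDerivAt 0 hl
  have hv := hc (B.flip v)
  have hw := hc (B.flip w)
  have hJv := hc ((B.comp J).flip v)
  have hJw := hc ((B.comp J).flip w)
  have hq : HasDerivAt (fun t : ℝ => B (y + t • u) (y + t • u)) (B u y + B y u) 0 := by
    have h1 : HasDerivAt (fun t : ℝ => B (y + t • u)) (B u) 0 :=
      B.hasFDerivAt.comp_hasDerivAt 0 hl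
    simpa using h1.clm_apply hl
  have hk := (hasDerivAt_const (0 : ℝ) c).fun_div ((hq.const_mul c).const_sub 1) (by simpa using hy)
  have htot := ((hk.fun_mul (hv.fun_mul hw)).const_add (B v w)).fun_sub
    ((hJv.fun_mul hJw).const_mul (((ε : ℤ) : ℝ) * c))
  have heq : (fun t : ℝ => modelMetric ε c B J (y + t • u) v w) = fun t : ℝ =>
      B v w + c / (1 - c * B (y + t • u) (y + t • u)) * (B.flip v (y + t • u) *
        B.flip w (y + t • u)) - ((ε : ℤ) : ℝ) * c * ((B.comp J).flip v (y + t • u) *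
        (B.comp J).flip w (y + t • u)) := by
    funext t
    rw [modelMetric_apply]; rfl
  rw [heq] at hline
  rw [← e1, hline.unique htot]
  simp only [zero_smul, add_zero, ContinuousLinearMap.flip_apply, ContinuousLinearMap.comp_apply,
    hB u y]
  field_simp
  ring

/-- The Christoffel symbols of the model metric vanish at `0`, and this is their differential. -/
lemma christoffel_modelMetric [FiniteDimensional ℝ E] (h : IsCompatible ε B J) (v w : E) :
    christoffel (modelMetric ε c B J) 0 v w = 0 ∧ ∀ u : E,
    fderiv ℝ (fun z => christoffel (modelMetric ε c B J) z v w) 0 u =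
      (c * B v w) • u - (((ε : ℤ) : ℝ) * c) • (B (J u) w • J v + B (J u) v • J w) := by
  have := FiniteDimensional.complete ℝ E
  set G := modelMetric ε c B J with hGdef
  have hG0 : G 0 = B := modelMetric_zero
  have hi : (G 0).IsInvertible := hG0 ▸ h.isInvertible
  have hs : ContDiffAt ℝ 2 G 0 := contDiffAt_modelMetric (by simp)
  have hΓ := differentiableAt_christoffelL hs hi
  have h0 : christoffel G 0 v w = 0 := by
    have : christoffelFirst G 0 v w = 0 := by
      ext t
      rw [christoffelFirst_apply, fderiv_modelMetric h.symm (by simp),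
        fderiv_modelMetric h.symm (by simp), fderiv_modelMetric h.symm (by simp)]
      simp
    rw [christoffel, this, map_zero]
  refine ⟨h0, fun u => ?_⟩
  have hΓd : DifferentiableAt ℝ (fun z => christoffel G z v w) 0 := by
    simp only [← christoffelL_apply]
    exact (hΓ.clm_apply (differentiableAt_const v)).clm_apply (differentiableAt_const w)
  have hGd := hs.differentiableAt two_ne_zero
  refine sub_eq_zero.1 (h.nondegenerate _ fun t => ?_)
  -- differentiate `⟨Γ(v,w), t⟩` along the line `s ↦ s u`
  have e1 : fderiv ℝ (fun z => G z (christoffel G z v w) t) 0 u =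
      B (fderiv ℝ (fun z => christoffel G z v w) 0 u) t := by
    rw [fderiv_clm_apply (hGd.clm_apply hΓd) (differentiableAt_const t),
      fderiv_clm_apply hGd hΓd, h0, hG0]
    simp
  have hl : HasDerivAt (fun s : ℝ => s • u) u 0 := by
    simpa using (hasDerivAt_id (0 : ℝ)).smul_const u
  have hline : HasDerivAt (fun s : ℝ => G (s • u) (christoffel G (s • u) v w) t)
      (fderiv ℝ (fun z => G z (christoffel G z v w) t) 0 u) 0 := by
    have h2 : HasFDerivAt (fun z => G z (christoffel G z v w) t)
        (fderiv ℝ (fun z => G z (christoffel G z v w) t) 0) ((0 : ℝ) • u) := by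
      simpa using ((hGd.clm_apply hΓd).clm_apply (differentiableAt_const t)).hasFDerivAt
    exact h2.comp_hasDerivAt 0 hl
  have hinv : ∀ᶠ z in 𝓝 (0 : E), (G z).IsInvertible := by
    obtain ⟨e, he⟩ := hi
    have h1 : Set.range ((↑) : (E ≃L[ℝ] (E →L[ℝ] ℝ)) → E →L[ℝ] (E →L[ℝ] ℝ)) ∈ 𝓝 (G 0) := by
      rw [← he]; exact ContinuousLinearEquiv.nhds e
    filter_upwards [hGd.continuousAt.eventually_mem h1] with z hz using hz
  have htend : Filter.Tendsto (fun s : ℝ => s • u) (𝓝 0) (𝓝 0) := by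
    simpa using hl.continuousAt.tendsto
  -- along that line, `⟨Γ(v,w), t⟩` is the product of `s` and a differentiable function
  have hline2 : (fun s : ℝ => G (s • u) (christoffel G (s • u) v w) t) =ᶠ[𝓝 0] fun s : ℝ =>
      s * (c / (1 - c * (s ^ 2 * B u u)) * (B v w * B u t)
        + s ^ 2 * (c ^ 2 * (B u v * B u w * B u t) / (1 - c * (s ^ 2 * B u u)) ^ 2)
        - ((ε : ℤ) : ℝ) * c * (B (J u) w * B (J v) t + B (J u) v * B (J w) t)) := by
    filter_upwards [htend.eventually hinv,
      htend.eventually (eventually_ne_zero_modelMetric (c := c) (B := B))] with s hs1 hs2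
    rw [metric_christoffel hs1, christoffelFirst_apply, fderiv_modelMetric h.symm hs2,
      fderiv_modelMetric h.symm hs2, fderiv_modelMetric h.symm hs2]
    have e2 : B (J v) w = -B (J w) v := by rw [h.skew v w, h.symm]
    have e3 : B (J t) v = -B (J v) t := by rw [h.skew t v, h.symm]
    have e4 : B (J t) w = -B (J w) t := by rw [h.skew t w, h.symm]
    simp only [map_smul, smul_apply, smul_eq_mul, h.symm w v, h.symm t v, h.symm t w, e2, e3, e4]
      at hs2 ⊢
    have hs3 : 1 - c * (s ^ 2 * B u u) ≠ 0 := by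
      intro h'; apply hs2; rw [← h']; ring
    have hs4 : 1 - c * (s * (s * B u u)) = 1 - c * (s ^ 2 * B u u) := by ring
    rw [hs4]
    field_simp
    ring
  have hq : DifferentiableAt ℝ (fun s : ℝ => c / (1 - c * (s ^ 2 * B u u)) * (B v w * B u t)
        + s ^ 2 * (c ^ 2 * (B u v * B u w * B u t) / (1 - c * (s ^ 2 * B u u)) ^ 2)
        - ((ε : ℤ) : ℝ) * c * (B (J u) w * B (J v) t + B (J u) v * B (J w) t)) 0 := by
    have hd : DifferentiableAt ℝ (fun s : ℝ => 1 - c * (s ^ 2 * B u u)) 0 := by fun_prop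
    have k1 : DifferentiableAt ℝ (fun s : ℝ => c / (1 - c * (s ^ 2 * B u u))) 0 :=
      (differentiableAt_const c).fun_div hd (by simp)
    have k2 : DifferentiableAt ℝ (fun s : ℝ => c ^ 2 * (B u v * B u w * B u t) /
        (1 - c * (s ^ 2 * B u u)) ^ 2) 0 :=
      (differentiableAt_const _).fun_div (hd.fun_pow 2) (by simp)
    fun_prop
  have htot := ((hasDerivAt_id' (0 : ℝ)).fun_mul hq.hasDerivAt).congr_of_eventuallyEq hline2
  have e5 := hline.unique htot
  rw [e1] at e5
  rw [map_sub, _root_.sub_apply, e5]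
  simp only [map_sub, map_add, map_smul, _root_.sub_apply, add_apply, smul_apply, smul_eq_mul]
  ring

/-- The model metric has the curvature of a space form at `0`. -/
lemma hasModelCurvatureAt_modelMetric [FiniteDimensional ℝ E] (h : IsCompatible ε B J)
    {G : E → E →L[ℝ] E →L[ℝ] ℝ} (hG : G =ᶠ[𝓝 0] modelMetric ε c B J) :
    HasModelCurvatureAt ε (((ε : ℤ) : ℝ) * c) G J 0 where
  smooth := (contDiffAt_modelMetric (by simp)).congr_of_eventuallyEq hG
  symm := by
    filter_upwards [hG] with y hy u v
    rw [hy, modelMetric_apply, modelMetric_apply, h.symm u v]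
    ring
  compatible := by rw [hG.self_of_nhds, modelMetric_zero]; exact h
  curvature_eq u v w := by
    have h1 (a b : E) := (christoffel_modelMetric (c := c) h a b).1
    have h2 (a b : E) := (christoffel_modelMetric (c := c) h a b).2
    rw [curvature_congr hG, hG.self_of_nhds, modelMetric_zero, curvature, h2, h2, h1, h1]
    have e := unit_mul_self ε
    have e1 : B (J v) u = B u (J v) := h.symm _ _
    have e2 : B (J u) v = -B u (J v) := h.skew u v
    rw [e2, e1, modelCurvature]
    match_scalars
    · linear_combination (-c * B v w) * e
    · ring
    · ring
    · linear_combination (c * B u w) * e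
    · ring

end ModelMetric

end PseudoRiem

/-! ### The quotients of hyperquadrics -/

namespace SpaceFormModel

section ModelSpace

-- needed for the norms on iterated spaces of continuous linear maps
set_option maxSynthPendingDepth 3

variable {n p : ℕ} {ε c : ℤˣ}

variable (n ε) in
/-- Multiplication by the imaginary unit, as a continuous linear map. -/
def JL : Amb n →L[ℝ] Amb n :=
  LinearMap.toContinuousLinearMap
    { toFun := J ε
      map_add' := fun z w => by
        funext j
        ext
        · simp [J, act, amul]; ring
        · simp [J, act, amul]
      map_smul' := fun r z => by
        funext j
        ext
        · simp [J, act, amul]; ring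
        · simp [J, act, amul] }

lemma JL_apply (z : Amb n) : JL n ε z = J ε z := rfl

lemma J_J (z : Amb n) : J ε (J ε z) = (-sgn ε) • z := by
  rw [J, J, act_act, ← act_real (ε := ε)]; congr 1; simp [amul]

lemma form_nondegenerate {z : Amb n} (h : ∀ w, form p ε z w = 0) : z = 0 := by
  have hc (j : ℕ) : coeff p j ≠ 0 := by unfold coeff; split_ifs <;> norm_num
  have hs : sgn ε ≠ 0 := PseudoRiem.unit_ne_zero ε
  funext j
  have h1 := h (Pi.single j (1, 0))
  have h2 := h (Pi.single j (0, 1))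
  rw [form, Finset.sum_eq_single j (fun k _ hk => by simp [Pi.single_eq_of_ne hk]) (by simp)]
    at h1 h2
  ext
  · simpa [hc] using h1
  · simpa [hc, hs] using h2

lemma coef_J (z₀ : Quadric n p ε c) (z : Amb n) : coef z₀ (J ε z) = amul ε (0, 1) (coef z₀ z) :=
  coef_act z₀ _ z

/-- The scalar product of the model vector space of a chart. -/
def chartForm (z₀ : Quadric n p ε c) : Mod n →L[ℝ] Mod n →L[ℝ] ℝ :=
  (formL n p ε).bilinearComp (ofMod z₀) (ofMod z₀)

/-- The (para-)complex structure of the model vector space of a chart. -/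
def chartJ (z₀ : Quadric n p ε c) : Mod n →L[ℝ] Mod n :=
  (toMod z₀).comp ((JL n ε).comp (ofMod z₀))

lemma chartForm_apply (z₀ : Quadric n p ε c) (u v : Mod n) :
    chartForm z₀ u v = form p ε (ofMod z₀ u) (ofMod z₀ v) := rfl

lemma ofMod_chartJ (z₀ : Quadric n p ε c) (u : Mod n) :
    ofMod z₀ (chartJ z₀ u) = J ε (ofMod z₀ u) := by
  change ofMod z₀ (toMod z₀ (J ε (ofMod z₀ u))) = _
  rw [ofMod_toMod, coef_J, coef_horizontal _ _ (ofMod_mem z₀ u), act_eq]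
  simp [amul]

lemma isCompatible_chartForm (z₀ : Quadric n p ε c) :
    PseudoRiem.IsCompatible ε (chartForm z₀) (chartJ z₀) where
  symm u v := form_comm _ _
  nondegenerate u hu := by
    have h : ofMod z₀ u = 0 := form_nondegenerate (p := p) (ε := ε) fun w => by
      have h1 := hu (toMod z₀ w)
      have hm := ofMod_mem z₀ u
      rw [chartForm_apply, ofMod_toMod, sub_eq_add_neg, ← neg_one_smul ℝ, form_add_right,
        form_smul_right, act_eq, form_add_right, form_smul_right, form_smul_right, hm.1, hm.2] at h1
      simpa using h1
    rw [← toMod_ofMod z₀ u, h, map_zero]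
  sq u := by
    rw [← toMod_ofMod z₀ (chartJ z₀ (chartJ z₀ u)), ofMod_chartJ, ofMod_chartJ, J_J, map_smul,
      toMod_ofMod]
    rfl
  compatible u v := by
    rw [chartForm_apply, ofMod_chartJ, ofMod_chartJ, form_J_J]; rfl

lemma toMod_J_base (z₀ : Quadric n p ε c) : toMod z₀ (J ε z₀.1) = 0 := by
  rw [← toMod_ofMod z₀ (toMod z₀ (J ε z₀.1)), ofMod_toMod, coef_J, coef_self]
  simp [amul, act_eq]

/-- The differential at `z₀` of the coordinates centred at `z₀` is the orthogonal projection to the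
horizontal subspace. -/
lemma hasFDerivAt_coord (z₀ : Quadric n p ε c) : HasFDerivAt (coord z₀) (toMod z₀) z₀.1 := by
  have hc := (contDiff_coef z₀).contDiffAt (x := z₀.1) |>.differentiableAt (by simp)
  have h1 := hc.fst.hasFDerivAt
  have h2 := hc.snd.hasFDerivAt
  have hr : DifferentiableAt ℝ (fun z => (√(nsq ε (coef z₀ z)))⁻¹) z₀.1 := by
    refine DifferentiableAt.inv (DifferentiableAt.sqrt ?_ ?_) ?_
    · exact (contDiff_nsq_coef z₀).contDiffAt.differentiableAt (by simp)
    · simp [coef_self, nsq]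
    · simp [coef_self, nsq]
  have hJ : HasFDerivAt (fun z => toMod z₀ (J ε z)) ((toMod z₀).comp (JL n ε)) z₀.1 :=
    ((toMod z₀).comp (JL n ε)).hasFDerivAt
  have h3 := (h1.fun_smul (toMod z₀).hasFDerivAt).fun_sub (h2.fun_smul hJ)
  have h4 := hr.hasFDerivAt.fun_smul h3
  have e : coord z₀ = fun z => (√(nsq ε (coef z₀ z)))⁻¹ •
      ((coef z₀ z).1 • toMod z₀ z - (coef z₀ z).2 • toMod z₀ (J ε z)) := by
    funext z
    rw [coord, act_eq, map_add, map_smul, map_smul]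
    simp [conj, sub_eq_add_neg]
  rw [e]
  refine h4.congr_fderiv ?_
  ext1 u
  simp [coef_self, nsq, toMod_base, toMod_J_base]

/-- The differential of the slice `y ↦ √(1 - c ⟨y,y⟩) z₀ + y`. -/
lemma hasFDerivAt_lift (z₀ : Quadric n p ε c) {y : Mod n} (hy : 0 < radicand z₀ y) :
    ∃ L : Mod n →L[ℝ] Amb n, HasFDerivAt (lift z₀) L y ∧
      ∀ u, L u = (-(sgn c * chartForm z₀ y u) / √(radicand z₀ y)) • z₀.1 + ofMod z₀ u := by
  have hB : HasFDerivAt (fun y => chartForm z₀ y) (chartForm z₀) y := (chartForm z₀).hasFDerivAt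
  have hq := hB.clm_apply (hasFDerivAt_id y)
  have hr : HasFDerivAt (radicand z₀) _ y := (hq.const_mul (sgn c)).const_sub 1
  refine ⟨_, ((hr.sqrt hy.ne').smul_const z₀.1).add (ofMod z₀).hasFDerivAt, fun u => ?_⟩
  have hs := (isCompatible_chartForm z₀).symm u y
  have hne := (Real.sqrt_pos.2 hy).ne'
  simp [hs]
  congr 1
  field_simp
  ring

/-- The scalar product of the horizontal parts `k - ⟨k,z₀⟩ c z₀ - ⟨k,Jz₀⟩ εc Jz₀` of two vectors. -/
lemma form_ofMod_toMod (z₀ : Quadric n p ε c) (k m : Amb n) :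
    form p ε (ofMod z₀ (toMod z₀ k)) (ofMod z₀ (toMod z₀ m)) =
      form p ε k m - sgn c * (form p ε k z₀.1 * form p ε m z₀.1)
        - sgn ε * sgn c * (form p ε k (J ε z₀.1) * form p ε m (J ε z₀.1)) := by
  have hm := ofMod_mem z₀ (toMod z₀ k)
  have e : form p ε (ofMod z₀ (toMod z₀ k)) (ofMod z₀ (toMod z₀ m)) =
      form p ε (ofMod z₀ (toMod z₀ k)) m := by
    rw [ofMod_toMod z₀ m, sub_eq_add_neg, ← neg_one_smul ℝ, form_add_right, form_smul_right, act_eq,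
      form_add_right, form_smul_right, form_smul_right, hm.1, hm.2]
    simp
  rw [e, ofMod_toMod, sub_eq_add_neg, ← neg_one_smul ℝ, form_add_left, form_smul_left, act_eq,
    form_add_left, form_smul_left, form_smul_left, form_comm z₀.1 m, form_comm (J ε z₀.1) m]
  simp only [coef]
  ring

lemma act_J (a : ℝ × ℝ) (z : Amb n) : act ε a (J ε z) = J ε (act ε a z) := by
  rw [J, J, act_act, act_act]; congr 1; simp [amul]

/-- The differential of the inverse of a chart. Tangent vectors at a point `x` are read in the
preferred chart `chart (rep x)`, so the lift has to be rotated by the phase that takes it to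
`rep x`. -/
lemma mfderiv_chart_symm (z₀ : Quadric n p ε c) {y : Mod n} (hy : 0 < radicand z₀ y) {θ : ℝ}
    (hθ : (rep ((chart z₀).symm y)).1 = act ε (phase ε θ) (lift z₀ y))
    {L : Mod n →L[ℝ] Amb n} (hL : HasFDerivAt (lift z₀) L y) (u : Mod n) :
    (mfderiv 𝓘(ℝ, Mod n) 𝓘(ℝ, Mod n) (chart z₀).symm y u : Mod n) =
      toMod (rep ((chart z₀).symm y)) (act ε (phase ε θ) (L u)) := by
  set z' := rep ((chart z₀).symm y) with hz'
  have hψ : chart z₀ ∈ PseudoRiem.smoothCharts (Mod n) (SpaceForm n p ε c) :=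
    IsManifold.subset_maximalAtlas ⟨z₀, rfl⟩
  have hmd : MDifferentiableAt 𝓘(ℝ, Mod n) 𝓘(ℝ, Mod n) (chart z₀).symm y :=
    (PseudoRiem.mdifferentiable_of_mem_smoothCharts hψ).mdifferentiableAt_symm hy
  have hchart : chartAt (Mod n) ((chart z₀).symm y) = chart z' := rfl
  let P : Amb n →L[ℝ] Amb n := LinearMap.toContinuousLinearMap
    { toFun := act ε (phase ε θ)
      map_add' := fun z w => by
        rw [act_eq, act_eq, act_eq, ← JL_apply, map_add, JL_apply, JL_apply]; module
      map_smul' := fun r z => by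
        rw [act_eq, act_eq, ← JL_apply, map_smul, JL_apply, RingHom.id_apply]; module }
  have hwr : writtenInExtChartAt 𝓘(ℝ, Mod n) 𝓘(ℝ, Mod n) y (chart z₀).symm =ᶠ[𝓝 y]
      fun w => coord z' (P (lift z₀ w)) := by
    have hop : IsOpen {w | 0 < radicand z₀ w} := (chart z₀).open_target
    filter_upwards [hop.mem_nhds hy] with w hw
    simp only [writtenInExtChartAt, extChartAt, hchart]
    change chartFun z' (chartInv z₀ w) = coord z' (act ε (phase ε θ) (lift z₀ w))
    rw [chartInv_of_pos z₀ w hw, coord_phase]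
    rfl
  have hD : HasFDerivAt (fun w => coord z' (P (lift z₀ w))) ((toMod z').comp (P.comp L)) y := by
    have h1 : HasFDerivAt (coord z') (toMod z') (P (lift z₀ y)) := by
      change HasFDerivAt (coord z') (toMod z') (act ε (phase ε θ) (lift z₀ y))
      rw [← hθ]
      exact hasFDerivAt_coord z'
    exact h1.comp y (P.hasFDerivAt.comp y hL)
  have hd : mfderiv 𝓘(ℝ, Mod n) 𝓘(ℝ, Mod n) (chart z₀).symm y = (toMod z').comp (P.comp L) := by
    have h1 : mfderiv 𝓘(ℝ, Mod n) 𝓘(ℝ, Mod n) (chart z₀).symm y = fderivWithin ℝ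
        (writtenInExtChartAt 𝓘(ℝ, Mod n) 𝓘(ℝ, Mod n) y (chart z₀).symm)
        (Set.range 𝓘(ℝ, Mod n)) ((extChartAt 𝓘(ℝ, Mod n) y) y) := by
      rw [mfderiv]
      exact if_pos hmd
    rw [h1]
    simp only [modelWithCornersSelf_coe, Set.range_id, fderivWithin_univ,
      extChartAt_model_space_eq_id, PartialEquiv.refl_coe, id]
    exact hwr.fderiv_eq.trans hD.fderiv
  rw [hd]
  rfl

lemma metric_apply (x : SpaceForm n p ε c) (u v : Mod n) :
    metric n p ε c x u v = form p ε (ofMod (rep x) u) (ofMod (rep x) v) := by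
  change form p ε (horLift x u : Amb n) (horLift x v : Amb n) = _
  rw [horLift_apply, horLift_apply]

/-- The metric of the quotient of the hyperquadric in the chart centred at `z₀`. -/
lemma metric_inChart (z₀ : Quadric n p ε c) {y : Mod n} (hy : 0 < radicand z₀ y) :
    (metric n p ε c).inChart (chart z₀) y =
      PseudoRiem.modelMetric ε (sgn c) (chartForm z₀) (chartJ z₀) y := by
  obtain ⟨L, hL, hLu⟩ := hasFDerivAt_lift z₀ hy
  have hx : (chart z₀).symm y = proj ⟨lift z₀ y, lift_mem z₀ y hy.le⟩ := chartInv_of_pos z₀ y hy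
  obtain ⟨θ, hθ⟩ := (proj_eq_iff ⟨lift z₀ y, lift_mem z₀ y hy.le⟩
    (rep ((chart z₀).symm y))).1 (by rw [proj_rep, hx])
  -- the slice is tangent to the hyperquadric, and `J (lift z₀ y)` spans the vertical direction
  have h1 (w : Mod n) : form p ε (L w) (lift z₀ y) = 0 := by
    have hm := ofMod_mem z₀ w
    have hm' := ofMod_mem z₀ y
    have hs := (Real.sqrt_pos.2 hy).ne'
    have e := sgn_sq c
    have e1 : form p ε z₀.1 (ofMod z₀ y) = 0 := by rw [form_comm]; exact hm'.1
    rw [hLu, lift, form_add_left, form_smul_left, form_add_right, form_add_right, form_smul_right,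
      form_smul_right, hm.1, z₀.2, e1, form_comm (ofMod z₀ w), ← chartForm_apply]
    field_simp
    linear_combination (-chartForm z₀ y w * √(radicand z₀ y)) * e
  have h2 (w : Mod n) : form p ε (L w) (J ε (lift z₀ y)) = chartForm z₀ (chartJ z₀ y) w := by
    have hm := ofMod_mem z₀ w
    have e1 : form p ε z₀.1 (J ε (ofMod z₀ y)) = 0 := by
      rw [form_comm, ← ofMod_chartJ]; exact (ofMod_mem z₀ _).1
    have e2 : J ε (lift z₀ y) = √(radicand z₀ y) • J ε z₀.1 + J ε (ofMod z₀ y) := by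
      rw [lift, ← JL_apply, map_add, map_smul]; rfl
    rw [e2, hLu, form_add_left, form_smul_left, form_add_right, form_add_right, form_smul_right,
      form_smul_right, form_J_self, e1, hm.2, chartForm_apply z₀ (chartJ z₀ y),
      ofMod_chartJ, form_comm (ofMod z₀ w)]
    ring
  have h3 (u v : Mod n) : form p ε (L u) (L v) = chartForm z₀ u v
      + sgn c / radicand z₀ y * (chartForm z₀ y u * chartForm z₀ y v) := by
    have hm := ofMod_mem z₀ u
    have hm' := ofMod_mem z₀ v
    have e1 : form p ε z₀.1 (ofMod z₀ v) = 0 := by rw [form_comm]; exact hm'.1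
    have hs := Real.mul_self_sqrt hy.le
    have hne := (Real.sqrt_pos.2 hy).ne'
    have e := sgn_sq c
    rw [hLu, hLu]
    generalize √(radicand z₀ y) = s at hs hne
    rw [form_add_left, form_smul_left, form_add_right, form_add_right, form_smul_right,
      form_smul_right, hm.1, e1, z₀.2, ← chartForm_apply, ← hs]
    field_simp
    linear_combination (sgn c * chartForm z₀ y u * chartForm z₀ y v) * e
  ext u v
  rw [PseudoRiem.BilinField.inChart_apply, PseudoRiem.modelMetric_apply]
  refine (metric_apply _ _ _).trans ?_
  rw [mfderiv_chart_symm z₀ hy hθ hL, mfderiv_chart_symm z₀ hy hθ hL, form_ofMod_toMod, hθ,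
    ← act_J]
  simp only [form_act_act, nsq_phase, one_mul, h1, h2, h3, mul_zero, sub_zero]
  rfl

lemma chart_rep_self (x : SpaceForm n p ε c) : chart (rep x) x = 0 := by
  have h : chart (rep x) (proj (rep x)) = 0 := by
    change coord (rep x) (rep x).1 = 0
    rw [coord, coef_self]
    simp [conj, act_real, toMod_base]
  rwa [proj_rep] at h

/-- The quotients of hyperquadrics are space forms of curvature `4εc`, as seen at the origin of the
chart centred at an arbitrary point. -/
lemma hasModelCurvatureAt (x : SpaceForm n p ε c) :
    PseudoRiem.HasModelCurvatureAt ε (sgn ε * sgn c) ((metric n p ε c).inChart (chart (rep x)))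
      (chartJ (rep x)) (chart (rep x) x) := by
  rw [chart_rep_self]
  refine PseudoRiem.hasModelCurvatureAt_modelMetric (isCompatible_chartForm (rep x)) ?_
  have hop : IsOpen {w | 0 < radicand (rep x) w} := (chart (rep x)).open_target
  filter_upwards [hop.mem_nhds (by simp [radicand, form] : (0 : Mod n) ∈ _)] with y hy
  exact metric_inChart _ hy

end ModelSpace

end SpaceFormModel

end

theorem theorem1 (n : ℕ) (hn : 2 ≤ n) (ε : ℤˣ) :
    -- every manifold with the structure of a (para-)complex space form of curvature `4c ≠ 0`
    (∀ (M : Type*) [TopologicalSpace M] [ChartedSpace (EuclideanSpace ℝ (Fin (2 * n))) M]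
        [IsManifold 𝓘(ℝ, EuclideanSpace ℝ (Fin (2 * n))) ∞ M]
        (c : ℝ) (g : PseudoRiem.BilinField (EuclideanSpace ℝ (Fin (2 * n))) M)
        (J : PseudoRiem.EndField (EuclideanSpace ℝ (Fin (2 * n))) M),
        c ≠ 0 → PseudoRiem.IsSpaceForm ε c g J →
      ∀ (S : Type*) [TopologicalSpace S] [ChartedSpace (EuclideanSpace ℝ (Fin (2 * n - 1))) S]
        [IsManifold 𝓘(ℝ, EuclideanSpace ℝ (Fin (2 * n - 1))) ∞ S] [Nonempty S] (f : S → M),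
        PseudoRiem.IsNondegenerateHypersurface (EuclideanSpace ℝ (Fin (2 * n - 1))) g f →
          ¬ PseudoRiem.IsUmbilic (EuclideanSpace ℝ (Fin (2 * n - 1))) g f ∧
          ¬ PseudoRiem.HasParallelShapeOperator (EuclideanSpace ℝ (Fin (2 * n - 1))) g f) ∧
    -- the quotients of hyperquadrics of curvature `± 4`
    (∀ (p : ℕ) (c : ℤˣ)
        (S : Type*) [TopologicalSpace S] [ChartedSpace (EuclideanSpace ℝ (Fin (2 * n - 1))) S]
        [IsManifold 𝓘(ℝ, EuclideanSpace ℝ (Fin (2 * n - 1))) ∞ S] [Nonempty S]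
        (f : S → SpaceFormModel.SpaceForm n p ε c),
        PseudoRiem.IsNondegenerateHypersurface (EuclideanSpace ℝ (Fin (2 * n - 1)))
          (SpaceFormModel.metric n p ε c) f →
          ¬ PseudoRiem.IsUmbilic (EuclideanSpace ℝ (Fin (2 * n - 1)))
            (SpaceFormModel.metric n p ε c) f ∧
          ¬ PseudoRiem.HasParallelShapeOperator (EuclideanSpace ℝ (Fin (2 * n - 1)))
            (SpaceFormModel.metric n p ε c) f) := by
  have hE : 2 < Module.finrank ℝ (EuclideanSpace ℝ (Fin (2 * n))) := by
    rw [finrank_euclideanSpace_fin]; omega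
  refine ⟨?_, ?_⟩
  · intro M _ _ _ c g J hc hM S _ _ _ _ f hf
    obtain ⟨p⟩ := ‹Nonempty S›
    have hψ := IsManifold.chart_mem_maximalAtlas (I := 𝓘(ℝ, EuclideanSpace ℝ (Fin (2 * n))))
      (n := ∞) (f p)
    exact hf.not_umbilic_and_not_parallel hc hE hψ p (mem_chart_source _ (f p))
      (hM.hasModelCurvatureAt hψ (mem_chart_target _ (f p)))
  · intro p c S _ _ _ _ f hf
    obtain ⟨q⟩ := ‹Nonempty S›
    exact hf.not_umbilic_and_not_parallel
      (mul_ne_zero (PseudoRiem.unit_ne_zero ε) (PseudoRiem.unit_ne_zero c)) hE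
      (IsManifold.chart_mem_maximalAtlas (f q)) q (mem_chart_source _ (f q))
      (SpaceFormModel.hasModelCurvatureAt (f q))
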